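/- Let $m\ge 1$ be an integer and $\omega_j=\exp(ij\pi/m)$. Consider on the half-line $t\ge 0$ the equation $$(-1)^m Y^{(2m)}(t)+\sum_{\gamma=0}^{2m-2}Q_\gamma(t)\,Y^{(\gamma)}(t)=k^{2m}\,Y(t),\qquad k\in\mathbb C,\tag{1}$$ with coefficients of the form $$Q_\gamma(t)=(-1)^m(-i)^\gamma\sum_{n=1}^{\infty}p_{\gamma n}e^{-nt},\qquad \sum_{\gamma=0}^{2m-2}\sum_{n=1}^{\infty}n^{\gamma}|p_{\gamma n}|<\infty ,\tag{2}$$ where the $p_{\gamma n}$ are complex numbers. Put $k_{nj}=-\dfrac{in}{1-\omega_j}$ for $n\ge 1$ and $1\le j\le 2m-1$. For every $k$ different from all $k_{nj}$, equation (1) has a solution of the form $$f(t,k)=e^{ikt}+\sum_{j=1}^{2m-1}\sum_{\alpha=1}^{\infty}\sum_{n=1}^{\alpha}\frac{V^{(j)}_{n\alpha}}{in+k(1-\omega_j)}\,e^{(ik-\alpha)t}$$ with complex numbers $V^{(j)}_{n\alpha}$ independent of $k$ and $t$ (the series in $\alpha$, whose terms are the finite sums over $j$ and $n$, converges absolutely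 for $t\ge 0$, and the equation holds for $t>0$), and there are uniquely determined numbers $S_{nj}$ ($n\ge 1$, $1\le j\le 2m-1$), the spectral data of (1), such that $$\lim_{k\to k_{nj}}\bigl[in+k(1-\omega_j)\bigr]f(t,k)=S_{nj}\,f(t,k_{nj}\omega_j)\qquad\text{for all } t\ge 0 .$$ The coefficients $Q_\gamma$ are uniquely determined by the numbers $S_{nj}$: if two equations (1), with coefficients $Q_\gamma$ and $Q'_\gamma$ both of the form (2), have the same numbers $S_{nj}$ for all $n\ge 1$ and $1\le j\le 2m-1$, then $Q_\gamma(t)=Q'_\gamma(t)$ for all $t\ge 0$ and $0\le\gamma\le 2m-2$. -/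

import Mathlib

open Filter Topology

namespace GasymovInverse

noncomputable section

/-- The `2m`-th roots of unity `ω_j = exp (i j π / m)`. -/
def omega (m j : ℕ) : ℂ := Complex.exp (Complex.I * j * Real.pi / m)

/-- The points `k_{nj} = -i n / (1 - ω_j)`, where `1 ≤ n` and `1 ≤ j ≤ 2m - 1`. -/
def pole (m n j : ℕ) : ℂ := -(Complex.I * n) / (1 - omega m j)

/-- `k` is none of the points `k_{nj}`. -/
def IsRegularPoint (m : ℕ) (k : ℂ) : Prop :=
  ∀ n : ℕ, 1 ≤ n → ∀ j ∈ Finset.Icc 1 (2 * m - 1), k ≠ pole m n j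

/-- The class of coefficients: on the half-line `t ≥ 0`, for `0 ≤ γ ≤ 2m - 2`,
`Q_γ(t) = (-1)^m (-i)^γ ∑_{n ≥ 1} p_{γ n} e^{-n t}` with `∑_γ ∑_{n ≥ 1} n^γ |p_{γ n}| < ∞`.
The summation variable `n : ℕ` below stands for the index `n + 1`. -/
def InClass (m : ℕ) (Q : ℕ → ℝ → ℂ) : Prop :=
  ∃ p : ℕ → ℕ → ℂ,
    (∀ γ ∈ Finset.range (2 * m - 1),
      Summable fun n : ℕ => ((n + 1 : ℕ) : ℝ) ^ γ * ‖p γ (n + 1)‖) ∧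
    ∀ γ ∈ Finset.range (2 * m - 1), ∀ t : ℝ, 0 ≤ t →
      Q γ t = (-1) ^ m * (-Complex.I) ^ γ *
        ∑' n : ℕ, p γ (n + 1) * Complex.exp (-((n + 1 : ℕ) : ℂ) * t)

/-- `Y` is a classical solution, on the open half-line `t > 0`, of
`(-1)^m Y^{(2m)} + ∑_{γ = 0}^{2m - 2} Q_γ Y^{(γ)} = k^{2m} Y`. -/
def IsSolution (m : ℕ) (Q : ℕ → ℝ → ℂ) (k : ℂ) (Y : ℝ → ℂ) : Prop :=
  ContDiffOn ℝ ((2 * m : ℕ) : WithTop ℕ∞) Y (Set.Ioi 0) ∧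
  ∀ t : ℝ, 0 < t →
    (-1) ^ m * iteratedDeriv (2 * m) Y t
      + ∑ γ ∈ Finset.range (2 * m - 1), Q γ t * iteratedDeriv γ Y t = k ^ (2 * m) * Y t

/-- The term of index `α` of the series below:
`∑_{j = 1}^{2m - 1} ∑_{n = 1}^{α} V_{nα}^{(j)} / (i n + k (1 - ω_j)) · e^{(i k - α) t}`,
where `V j n α` is `V_{nα}^{(j)}`. -/
def seriesTerm (m : ℕ) (V : ℕ → ℕ → ℕ → ℂ) (t : ℝ) (k : ℂ) (α : ℕ) : ℂ :=
  (∑ j ∈ Finset.Icc 1 (2 * m - 1), ∑ n ∈ Finset.Icc 1 α,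
    V j n α / (Complex.I * n + k * (1 - omega m j)))
    * Complex.exp ((Complex.I * k - α) * t)

/-- `f(t, k) = e^{i k t} + ∑_{j = 1}^{2m - 1} ∑_{α ≥ 1} ∑_{n = 1}^{α}
V_{nα}^{(j)} / (i n + k (1 - ω_j)) · e^{(i k - α) t}`; the summation variable `a : ℕ` stands for
`α = a + 1`. -/
def seriesSol (m : ℕ) (V : ℕ → ℕ → ℕ → ℂ) (t : ℝ) (k : ℂ) : ℂ :=
  Complex.exp (Complex.I * k * t) + ∑' a : ℕ, seriesTerm m V t k (a + 1)

/-- The numbers `V_{nα}^{(j)}` yield, for every `k` that is none of the `k_{nj}`, a convergent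
series `f(t, k)`, `t ≥ 0`, which solves the equation with coefficients `Q_γ`. -/
def IsSolutionSystem (m : ℕ) (Q : ℕ → ℝ → ℂ) (V : ℕ → ℕ → ℕ → ℂ) : Prop :=
  ∀ k : ℂ, IsRegularPoint m k →
    (∀ t : ℝ, 0 ≤ t → Summable fun a : ℕ => seriesTerm m V t k (a + 1)) ∧
    IsSolution m Q k fun t => seriesSol m V t k

/-- The numbers `S_{nj}` (written `S n j`, for `n ≥ 1` and `1 ≤ j ≤ 2m - 1`) are the spectral data
of the equation with coefficients `Q_γ`: for the solution `f(t, k)` above and all `t ≥ 0`,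
`lim_{k → k_{nj}} (i n + k (1 - ω_j)) f(t, k) = S_{nj} f(t, k_{nj} ω_j)`. -/
def IsSpectralData (m : ℕ) (Q : ℕ → ℝ → ℂ) (S : ℕ → ℕ → ℂ) : Prop :=
  ∃ V : ℕ → ℕ → ℕ → ℂ, IsSolutionSystem m Q V ∧
    ∀ n : ℕ, 1 ≤ n → ∀ j ∈ Finset.Icc 1 (2 * m - 1), ∀ t : ℝ, 0 ≤ t →
      Tendsto (fun k : ℂ => (Complex.I * n + k * (1 - omega m j)) * seriesSol m V t k)
        (𝓝[≠] pole m n j) (𝓝 (S n j * seriesSol m V t (pole m n j * omega m j)))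

end

end GasymovInverse

/-!
Inserting `Y = ∑ c_α e^{(ik - α)t}`, `c_0 = 1`, into the equation and comparing the coefficients of
the exponentials turns it into the recursion
`((k + iα)^{2m} - k^{2m}) c_α + (-1)^m ∑_{β < α} q_{α-β}(k + iβ) c_β = 0`, where
`q_s(z) = ∑_γ p_{γs} z^γ` (`isSolution_expSum_iff`). The leading factor is `iα` times the product
of the `iα + k(1 - ω_j)`, so it vanishes only at the points `k_{αj}` (`charDiff_eq_prod`).

*Existence of `f`.* The points `k_{nj}` lie on the line `Im k = -n/2` and are pairwise distinct, so
the solution `c_α(k)` of the recursion is a proper rational function of `k` with simple poles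
at the `k_{nj}`, `n ≤ α`; its partial fractions give the numbers `V_{nα}^{(j)}`
(`isPartialFraction_recCoeff`). As the leading factor grows like `α^{2m}` and `q_s` has degree at
most `2m - 2`, any solution of the recursion is `O(α⁻²)`, uniformly for bounded `k`
(`exists_uniform_decay`).

*Spectral data.* Multiplying the recursion by `in + k(1 - ω_j)` and letting `k → k_{nj}` shows that
`β ↦ V_{n,n+β}^{(j)}` solves the recursion at `k_{nj} ω_j = k_{nj} + in`, which is in the upper
half-plane and hence no pole. Therefore `V_{n,n+β}^{(j)} = V_{nn}^{(j)} c_β(k_{nj} ω_j)`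
(`residue_eq_mul_solCoeff`), and by dominated convergence `S_{nj} = V_{nn}^{(j)}`
(`tendsto_linear_factor_mul_seriesSol`).

*Uniqueness.* By the same identity the `S_{nj}` determine all `V_{nα}^{(j)}` by induction on `α`
(`solCoeff_eq_of_diagonal_eq`). The functions `c_α(k)` in turn determine the polynomials
`q_s` one after the other from the recursion (`expansion_eq_of_solution_eq`), hence the
coefficients of the equation.
-/

namespace GasymovInverse

noncomputable section

/-! ### Roots of unity and the points `k_{nj}` -/

lemma isPrimitiveRoot_omega_one {m : ℕ} (hm : 1 ≤ m) : IsPrimitiveRoot (omega m 1) (2 * m) := by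
  have h := Complex.isPrimitiveRoot_exp (2 * m) (by omega)
  have hm' : (m : ℂ) ≠ 0 := by exact_mod_cast (by omega : m ≠ 0)
  convert h using 1
  unfold omega
  congr 1
  push_cast
  field_simp

lemma omega_eq_pow (m j : ℕ) : omega m j = omega m 1 ^ j := by
  unfold omega
  rw [← Complex.exp_nat_mul]
  congr 1
  push_cast
  ring

lemma norm_omega (m j : ℕ) : ‖omega m j‖ = 1 := by
  have : Complex.I * j * Real.pi / m = ((j * Real.pi / m : ℝ) : ℂ) * Complex.I := by
    push_cast; ring
  rw [omega, this, Complex.norm_exp_ofReal_mul_I]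

lemma omega_pow {m : ℕ} (hm : 1 ≤ m) (j : ℕ) : omega m j ^ (2 * m) = 1 := by
  rw [omega_eq_pow, ← pow_mul, mul_comm, pow_mul, (isPrimitiveRoot_omega_one hm).pow_eq_one,
    one_pow]

lemma omega_zero (m : ℕ) : omega m 0 = 1 := by simp [omega]

lemma omega_injOn {m : ℕ} (hm : 1 ≤ m) : Set.InjOn (omega m) (Finset.range (2 * m)) := by
  intro i hi j hj h
  rw [omega_eq_pow m i, omega_eq_pow m j] at h
  exact (isPrimitiveRoot_omega_one hm).pow_inj (by simpa using hi) (by simpa using hj) h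

lemma one_sub_omega_ne_zero {m j : ℕ} (hj : j ∈ Finset.Icc 1 (2 * m - 1)) :
    1 - omega m j ≠ 0 := by
  rw [Finset.mem_Icc] at hj
  intro h
  have h0 : omega m j = omega m 0 := by rw [omega_zero]; exact (sub_eq_zero.mp h).symm
  have := omega_injOn (m := m) (by omega) (by simp; omega) (by simp; omega) h0
  omega

/-- The linear factors in the denominators of `f(t, k)` vanish exactly at the points `k_{nj}`. -/
lemma linear_factor_eq {m n j : ℕ} (hj : j ∈ Finset.Icc 1 (2 * m - 1)) (k : ℂ) :
    Complex.I * n + k * (1 - omega m j) = (1 - omega m j) * (k - pole m n j) := by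
  have := one_sub_omega_ne_zero hj
  unfold pole
  field_simp
  ring

lemma linear_factor_ne_zero {m n j : ℕ} (hj : j ∈ Finset.Icc 1 (2 * m - 1)) {k : ℂ}
    (hk : k ≠ pole m n j) : Complex.I * n + k * (1 - omega m j) ≠ 0 := by
  rw [linear_factor_eq hj]
  exact mul_ne_zero (one_sub_omega_ne_zero hj) (sub_ne_zero.mpr hk)

/-- The points `k_{nj}` lie on the horizontal line of height `-n / 2`, because `1 / (1 - ω)` has
real part `1 / 2` for every `ω ≠ 1` on the unit circle. -/
lemma pole_im {m n j : ℕ} (hj : j ∈ Finset.Icc 1 (2 * m - 1)) : (pole m n j).im = -(n / 2 : ℝ) := by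
  have hw := one_sub_omega_ne_zero hj
  have h1 : Complex.normSq (omega m j) = 1 := by
    rw [Complex.normSq_eq_norm_sq, norm_omega]; norm_num
  have hw' : Complex.normSq (1 - omega m j) ≠ 0 := by simpa using hw
  have h2 : Complex.normSq (1 - omega m j) = 2 * (1 - omega m j).re := by
    rw [Complex.normSq_apply] at h1 ⊢
    simp only [Complex.sub_re, Complex.sub_im, Complex.one_re, Complex.one_im]
    linarith
  have h3 : (1 - omega m j).re ≠ 0 := by
    intro h; rw [h, mul_zero] at h2; exact hw' h2
  rw [pole, Complex.div_im, h2]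
  simp only [Complex.neg_im, Complex.neg_re, Complex.mul_im, Complex.mul_re, Complex.I_re,
    Complex.I_im, Complex.natCast_re, Complex.natCast_im]
  field_simp
  ring

lemma pole_inj {m n j n' j' : ℕ} (hn : 1 ≤ n) (hj : j ∈ Finset.Icc 1 (2 * m - 1))
    (hj' : j' ∈ Finset.Icc 1 (2 * m - 1)) (h : pole m n j = pole m n' j') : n = n' ∧ j = j' := by
  have him := congrArg Complex.im h
  rw [pole_im hj, pole_im hj'] at him
  have hnn : n = n' := by
    have : (n : ℝ) = n' := by linarith
    exact_mod_cast this
  subst hnn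
  refine ⟨rfl, ?_⟩
  have hn0 : Complex.I * (n : ℂ) ≠ 0 :=
    mul_ne_zero Complex.I_ne_zero (by exact_mod_cast (by omega : n ≠ 0))
  have h1 := one_sub_omega_ne_zero hj
  have h2 := one_sub_omega_ne_zero hj'
  unfold pole at h
  rw [div_eq_div_iff h1 h2] at h
  have h3 := mul_left_cancel₀ (neg_ne_zero.mpr hn0) h
  have h4 : omega m j = omega m j' := by linear_combination h3
  rw [Finset.mem_Icc] at hj hj'
  exact omega_injOn (m := m) (by omega) (by simp; omega) (by simp; omega) h4

/-- Rotating `k_{nj}` by `ω_j` is the same as shifting it by `i n`. -/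
lemma pole_mul_omega {m n j : ℕ} (hj : j ∈ Finset.Icc 1 (2 * m - 1)) :
    pole m n j * omega m j = pole m n j + Complex.I * n := by
  have := one_sub_omega_ne_zero hj
  unfold pole
  field_simp
  ring

lemma isRegularPoint_of_im_nonneg {m : ℕ} {k : ℂ} (hk : 0 ≤ k.im) : IsRegularPoint m k := by
  intro n hn j hj h
  have h1 : (1 : ℝ) ≤ n := by exact_mod_cast hn
  rw [h, pole_im hj] at hk
  linarith

lemma isRegularPoint_pole_mul_omega {m n j : ℕ} (hj : j ∈ Finset.Icc 1 (2 * m - 1)) :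
    IsRegularPoint m (pole m n j * omega m j) := by
  apply isRegularPoint_of_im_nonneg
  rw [pole_mul_omega hj, Complex.add_im, pole_im hj]
  simp

/-- The points `k_{nj}` are isolated. -/
lemma eventually_isRegularPoint {m n j : ℕ} (hj : j ∈ Finset.Icc 1 (2 * m - 1)) :
    ∀ᶠ k in 𝓝[≠] pole m n j, IsRegularPoint m k := by
  have h1 : ∀ᶠ k in 𝓝 (pole m n j), |k.im - (pole m n j).im| < 1 / 4 := by
    have : Tendsto (fun k : ℂ => |k.im - (pole m n j).im|) (𝓝 (pole m n j))
        (𝓝 |(pole m n j).im - (pole m n j).im|) :=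
      ((Complex.continuous_im.sub continuous_const).abs).tendsto _
    exact this.eventually_lt_const (by simp)
  have h2 : ∀ᶠ k in 𝓝 (pole m n j), ∀ j' ∈ Finset.Icc 1 (2 * m - 1),
      pole m n j' ≠ pole m n j → k ≠ pole m n j' := by
    rw [Finset.eventually_all]
    intro j' _
    by_cases h : pole m n j' = pole m n j
    · simp [h]
    · filter_upwards [isOpen_ne.mem_nhds (Ne.symm h)] with k hk _ using hk
  filter_upwards [h1.filter_mono nhdsWithin_le_nhds, h2.filter_mono nhdsWithin_le_nhds,
    self_mem_nhdsWithin] with k hk1 hk2 hk3 n' _ j' hj' hk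
  rw [hk, pole_im hj, pole_im hj', abs_lt] at hk1
  have hnn : n' = n := by
    have h3 : (n' : ℝ) < n + 1 := by linarith
    have h4 : (n : ℝ) < n' + 1 := by linarith
    have h5 : n' < n + 1 := by exact_mod_cast h3
    have h6 : n < n' + 1 := by exact_mod_cast h4
    omega
  subst hnn
  by_cases h : pole m n' j' = pole m n' j
  · exact hk3 (hk.trans h)
  · exact hk2 j' hj' h hk

/-- `(k + i α)^{2m} - k^{2m}`: the factor by which `(-1)^m d^{2m}/dt^{2m} - k^{2m}` multiplies
`e^{(ik - α)t}`. -/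
def charDiff (m α : ℕ) (k : ℂ) : ℂ := (k + Complex.I * α) ^ (2 * m) - k ^ (2 * m)

lemma charDiff_eq_prod {m : ℕ} (hm : 1 ≤ m) (α : ℕ) (k : ℂ) :
    charDiff m α k = Complex.I * α *
      ∏ j ∈ Finset.Icc 1 (2 * m - 1), (Complex.I * α + k * (1 - omega m j)) := by
  have hprim := isPrimitiveRoot_omega_one hm
  have h1 : charDiff m α k = ∏ j ∈ Finset.range (2 * m), (k + Complex.I * α - omega m j * k) := by
    rw [charDiff, hprim.pow_sub_pow_eq_prod_sub_mul _ _ (by omega)]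
    symm
    refine Finset.prod_nbij (omega m) ?_ (omega_injOn hm) ?_ (fun _ _ => rfl)
    · intro j _
      rw [Polynomial.mem_nthRootsFinset (by omega)]
      exact omega_pow hm j
    · intro ζ hζ
      rw [Finset.mem_coe, Polynomial.mem_nthRootsFinset (by omega)] at hζ
      have : NeZero (2 * m) := ⟨by omega⟩
      obtain ⟨i, hi, rfl⟩ := hprim.eq_pow_of_pow_eq_one hζ
      exact ⟨i, by simpa using hi, omega_eq_pow m i⟩
  obtain ⟨r, hr⟩ : ∃ r, 2 * m = r + 1 := ⟨2 * m - 1, by omega⟩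
  rw [h1, hr, Finset.prod_range_succ', omega_zero, Nat.add_sub_cancel, mul_comm]
  congr 1
  · ring
  · rw [Finset.range_eq_Ico, Finset.prod_Ico_add' (fun j => k + Complex.I * α - omega m j * k),
      zero_add, ← Finset.Ico_succ_right_eq_Icc]
    exact Finset.prod_congr rfl fun j _ => by ring

lemma charDiff_ne_zero {m : ℕ} (hm : 1 ≤ m) {α : ℕ} (hα : 1 ≤ α) {k : ℂ}
    (hk : IsRegularPoint m k) : charDiff m α k ≠ 0 := by
  rw [charDiff_eq_prod hm]
  refine mul_ne_zero (mul_ne_zero Complex.I_ne_zero (by exact_mod_cast (by omega : α ≠ 0))) ?_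
  exact Finset.prod_ne_zero_iff.mpr fun j hj => linear_factor_ne_zero hj (hk α hα j hj)

/-- At `k_{nj}` the factor for `n + β` is the factor for `β` at the rotated point `k_{nj} ω_j`,
since `(k_{nj} ω_j)^{2m} = k_{nj}^{2m}`. -/
lemma charDiff_pole {m n j : ℕ} (hm : 1 ≤ m) (hj : j ∈ Finset.Icc 1 (2 * m - 1)) (β : ℕ) :
    charDiff m (n + β) (pole m n j) = charDiff m β (pole m n j * omega m j) := by
  have h : (pole m n j * omega m j) ^ (2 * m) = pole m n j ^ (2 * m) := by
    rw [mul_pow, omega_pow hm, mul_one]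
  rw [charDiff, charDiff, h, pole_mul_omega hj]
  push_cast
  ring

/-! ### Exponential sums -/

/-- `∑_{α ≥ 0} c_α e^{(ik - α)t}`. -/
def expSum (c : ℕ → ℂ) (k : ℂ) (t : ℝ) : ℂ := ∑' α : ℕ, c α * Complex.exp ((Complex.I * k - α) * t)

/-- `∑ c_α e^{-αt}` converges absolutely for every `t > 0`; unlike summability at `t = 0`, this is
stable under differentiation. -/
def ExpSummable (c : ℕ → ℂ) : Prop :=
  ∀ t : ℝ, 0 < t → Summable fun α : ℕ => ‖c α‖ * Real.exp (-(α * t))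

lemma norm_exp_exponent (k : ℂ) (α : ℕ) (t : ℝ) :
    ‖Complex.exp ((Complex.I * k - α) * t)‖ = Real.exp (-(k.im * t)) * Real.exp (-(α * t)) := by
  rw [Complex.norm_exp, ← Real.exp_add]
  congr 1
  simp
  ring

lemma summable_norm_expSum_term {c : ℕ → ℂ} (hc : ExpSummable c) (k : ℂ) {t : ℝ} (ht : 0 < t) :
    Summable fun α : ℕ => ‖c α * Complex.exp ((Complex.I * k - α) * t)‖ := by
  refine ((hc t ht).mul_left (Real.exp (-(k.im * t)))).congr fun α => ?_
  rw [norm_mul, norm_exp_exponent]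
  ring

lemma ExpSummable.of_summable_norm {c : ℕ → ℂ} (hc : Summable fun α => ‖c α‖) : ExpSummable c := by
  intro t ht
  refine Summable.of_nonneg_of_le (fun α => by positivity) (fun α => ?_) hc
  refine mul_le_of_le_one_right (norm_nonneg _) (Real.exp_le_one_iff.mpr ?_)
  have : (0 : ℝ) ≤ α * t := by positivity
  linarith

lemma ExpSummable.add {c d : ℕ → ℂ} (hc : ExpSummable c) (hd : ExpSummable d) :
    ExpSummable fun α => c α + d α := by
  intro t ht
  refine Summable.of_nonneg_of_le (fun α => by positivity) (fun α => ?_) ((hc t ht).add (hd t ht))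
  rw [← add_mul]
  gcongr
  exact norm_add_le _ _

lemma ExpSummable.const_mul {c : ℕ → ℂ} (a : ℂ) (hc : ExpSummable c) :
    ExpSummable fun α => a * c α := by
  intro t ht
  refine ((hc t ht).mul_left ‖a‖).congr fun α => ?_
  rw [norm_mul]
  ring

lemma ExpSummable.sum {ι : Type*} {s : Finset ι} {c : ι → ℕ → ℂ}
    (hc : ∀ i ∈ s, ExpSummable (c i)) : ExpSummable fun α => ∑ i ∈ s, c i α := by
  classical
  induction s using Finset.induction_on with
  | empty => intro t _; simp
  | insert a s ha ih =>
    simp only [Finset.sum_insert ha]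
    exact (hc a (by simp)).add (ih fun i hi => hc i (by simp [hi]))

lemma ExpSummable.exponent_mul {c : ℕ → ℂ} (hc : ExpSummable c) (k : ℂ) :
    ExpSummable fun α => (Complex.I * k - α) * c α := by
  intro t ht
  refine Summable.of_nonneg_of_le (fun α => by positivity) (fun α => ?_)
    ((hc (t / 2) (by positivity)).mul_left (‖k‖ + 2 / t))
  have h1 : ‖Complex.I * k - α‖ ≤ ‖k‖ + α := by
    refine (norm_sub_le _ _).trans ?_
    simp
  -- half of the exponential absorbs the linear factor
  have h2 : (α : ℝ) ≤ 2 / t * Real.exp (α * (t / 2)) := by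
    have := Real.add_one_le_exp ((α : ℝ) * (t / 2))
    have h3 : (α : ℝ) = 2 / t * (α * (t / 2)) := by field_simp
    calc (α : ℝ) = 2 / t * (α * (t / 2)) := h3
      _ ≤ 2 / t * Real.exp (α * (t / 2)) := by gcongr; linarith
  have h3 : (1 : ℝ) ≤ Real.exp (α * (t / 2)) := Real.one_le_exp (by positivity)
  have h4 : Real.exp (-(α * t)) = Real.exp (-(α * (t / 2))) * Real.exp (-(α * (t / 2))) := by
    rw [← Real.exp_add]; congr 1; ring
  have h5 : Real.exp (α * (t / 2)) * Real.exp (-(α * (t / 2))) = 1 := by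
    rw [← Real.exp_add]; simp
  rw [norm_mul]
  calc ‖Complex.I * k - α‖ * ‖c α‖ * Real.exp (-(α * t))
      ≤ (‖k‖ * Real.exp (α * (t / 2)) + 2 / t * Real.exp (α * (t / 2))) * ‖c α‖ *
          Real.exp (-(α * t)) := by
        gcongr
        refine h1.trans (add_le_add ?_ h2)
        exact le_mul_of_one_le_right (norm_nonneg _) h3
    _ = (‖k‖ + 2 / t) * (‖c α‖ * Real.exp (-(α * (t / 2)))) := by
        rw [h4]
        linear_combination (‖k‖ + 2 / t) * ‖c α‖ * Real.exp (-(α * (t / 2))) * h5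

lemma ExpSummable.exponent_pow_mul {c : ℕ → ℂ} (hc : ExpSummable c) (k : ℂ) (γ : ℕ) :
    ExpSummable fun α => (Complex.I * k - α) ^ γ * c α := by
  induction γ with
  | zero => simpa using hc
  | succ γ ih =>
    have := ih.exponent_mul k
    simpa only [pow_succ', mul_assoc] using this

lemma expSum_add {c d : ℕ → ℂ} (hc : ExpSummable c) (hd : ExpSummable d) (k : ℂ) {t : ℝ}
    (ht : 0 < t) : expSum (fun α => c α + d α) k t = expSum c k t + expSum d k t := by
  unfold expSum
  rw [← (summable_norm_expSum_term hc k ht).of_norm.tsum_add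
    (summable_norm_expSum_term hd k ht).of_norm]
  exact tsum_congr fun α => by ring

lemma expSum_const_mul (a : ℂ) (c : ℕ → ℂ) (k : ℂ) (t : ℝ) :
    expSum (fun α => a * c α) k t = a * expSum c k t := by
  unfold expSum
  rw [← tsum_mul_left]
  exact tsum_congr fun α => by ring

lemma expSum_sum {ι : Type*} {s : Finset ι} {c : ι → ℕ → ℂ} (hc : ∀ i ∈ s, ExpSummable (c i))
    (k : ℂ) {t : ℝ} (ht : 0 < t) :
    expSum (fun α => ∑ i ∈ s, c i α) k t = ∑ i ∈ s, expSum (c i) k t := by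
  unfold expSum
  rw [← Summable.tsum_finsetSum fun i hi => (summable_norm_expSum_term (hc i hi) k ht).of_norm]
  exact tsum_congr fun α => by rw [Finset.sum_mul]

lemma hasDerivAt_expSum {c : ℕ → ℂ} (hc : ExpSummable c) (k : ℂ) {t : ℝ} (ht : 0 < t) :
    HasDerivAt (expSum c k) (expSum (fun α => (Complex.I * k - α) * c α) k t) t := by
  have hd := hc.exponent_mul k
  have hmem : t ∈ Set.Ioo (t / 2) (2 * t) := ⟨by linarith, by linarith⟩
  refine hasDerivAt_tsum_of_isPreconnected (t := Set.Ioo (t / 2) (2 * t))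
    (g := fun (α : ℕ) (s : ℝ) => c α * Complex.exp ((Complex.I * k - α) * s))
    (g' := fun (α : ℕ) (s : ℝ) =>
      (Complex.I * k - α) * c α * Complex.exp ((Complex.I * k - α) * s))
    (u := fun α : ℕ => Real.exp (|k.im| * (2 * t)) *
      (‖(Complex.I * k - α) * c α‖ * Real.exp (-(α * (t / 2)))))
    ((hd (t / 2) (by positivity)).mul_left _) isOpen_Ioo isPreconnected_Ioo ?_ ?_ hmem
    (summable_norm_expSum_term hc k ht).of_norm hmem
  · intro α y _
    have h1 : HasDerivAt (fun s : ℝ => (Complex.I * k - α) * (s : ℂ)) (Complex.I * k - α) y := by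
      simpa using (Complex.ofRealCLM.hasDerivAt (x := y)).const_mul (Complex.I * k - α)
    exact (h1.cexp.const_mul (c α)).congr_deriv (by ring)
  · intro α y hy
    rw [norm_mul, norm_exp_exponent]
    have h1 : Real.exp (-(k.im * y)) ≤ Real.exp (|k.im| * (2 * t)) := by
      apply Real.exp_le_exp.mpr
      have h2 : -(k.im * y) ≤ |k.im| * y := by
        have := neg_abs_le k.im
        nlinarith [hy.1]
      refine h2.trans ?_
      have := hy.2
      gcongr
    have h2 : Real.exp (-(α * y)) ≤ Real.exp (-(α * (t / 2))) := by
      apply Real.exp_le_exp.mpr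
      have := hy.1
      gcongr
    calc _ ≤ ‖(Complex.I * k - α) * c α‖ *
          (Real.exp (|k.im| * (2 * t)) * Real.exp (-(α * (t / 2)))) := by gcongr
      _ = _ := by ring

lemma iteratedDeriv_expSum {c : ℕ → ℂ} (hc : ExpSummable c) (k : ℂ) (γ : ℕ) {t : ℝ}
    (ht : 0 < t) : iteratedDeriv γ (expSum c k) t =
      expSum (fun α => (Complex.I * k - α) ^ γ * c α) k t := by
  induction γ generalizing t with
  | zero => simp
  | succ γ ih =>
    rw [iteratedDeriv_succ]
    have h : iteratedDeriv γ (expSum c k) =ᶠ[𝓝 t]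
        expSum (fun α => (Complex.I * k - α) ^ γ * c α) k := by
      filter_upwards [Ioi_mem_nhds ht] with s hs using ih hs
    rw [h.deriv_eq, (hasDerivAt_expSum (hc.exponent_pow_mul k γ) k ht).deriv]
    congr 1
    funext α
    ring

lemma contDiffOn_expSum {c : ℕ → ℂ} (hc : ExpSummable c) (k : ℂ) (n : ℕ) :
    ContDiffOn ℝ (n : WithTop ℕ∞) (expSum c k) (Set.Ioi 0) := by
  induction n generalizing c with
  | zero =>
    rw [Nat.cast_zero, contDiffOn_zero]
    exact fun t ht => (hasDerivAt_expSum hc k ht).continuousAt.continuousWithinAt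
  | succ n ih =>
    rw [Nat.cast_succ, contDiffOn_succ_iff_deriv_of_isOpen isOpen_Ioi]
    refine ⟨fun t ht => (hasDerivAt_expSum hc k ht).differentiableAt.differentiableWithinAt,
      by simp, (ih (hc.exponent_mul k)).congr fun t ht => (hasDerivAt_expSum hc k ht).deriv⟩

/-- The coefficients of an exponential sum are determined by its values for `t > 0`: the first
nonvanishing term would dominate as `t → ∞`. -/
lemma eq_zero_of_expSum_eq_zero {c : ℕ → ℂ} (hc : ExpSummable c) (k : ℂ)
    (h : ∀ t : ℝ, 0 < t → expSum c k t = 0) (α : ℕ) : c α = 0 := by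
  induction α using Nat.strong_induction_on with
  | _ α ih =>
    have hlim : Tendsto (fun t : ℝ => ∑' β : ℕ, c (β + α) * Complex.exp (-(β : ℂ) * t)) atTop
        (𝓝 (∑' β : ℕ, if β = 0 then c α else 0)) := by
      refine tendsto_tsum_of_dominated_convergence
        (bound := fun β : ℕ => ‖c (β + α)‖ * Real.exp (-((β : ℝ) * 1))) ?_ ?_ ?_
      · have h1 := ((summable_nat_add_iff α).mpr (hc 1 one_pos)).mul_left (Real.exp α)
        refine h1.congr fun β => ?_
        rw [mul_left_comm, ← Real.exp_add]
        congr 2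
        push_cast
        ring
      · intro β
        rcases Nat.eq_zero_or_pos β with rfl | hβ
        · simp
        · rw [if_neg (by omega), ← mul_zero (c (β + α))]
          refine Tendsto.const_mul _ ?_
          rw [tendsto_zero_iff_norm_tendsto_zero]
          have h2 : Tendsto (fun t : ℝ => Real.exp (-((β : ℝ) * t))) atTop (𝓝 0) :=
            Real.tendsto_exp_neg_atTop_nhds_zero.comp
              (tendsto_id.const_mul_atTop (by exact_mod_cast hβ))
          refine h2.congr fun t => ?_
          rw [Complex.norm_exp]
          simp
      · filter_upwards [eventually_ge_atTop (1 : ℝ)] with t ht β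
        rw [norm_mul, Complex.norm_exp]
        gcongr
        simp only [Complex.mul_re, Complex.neg_re, Complex.natCast_re, Complex.ofReal_re,
          Complex.neg_im, Complex.natCast_im, Complex.ofReal_im]
        nlinarith [(Nat.cast_nonneg β : (0 : ℝ) ≤ β)]
    have hzero : (fun t : ℝ => ∑' β : ℕ, c (β + α) * Complex.exp (-(β : ℂ) * t)) =ᶠ[atTop]
        fun _ => 0 := by
      filter_upwards [eventually_gt_atTop (0 : ℝ)] with t ht
      have h1 := (summable_norm_expSum_term hc k ht).of_norm.sum_add_tsum_nat_add α
      rw [← expSum, h t ht, Finset.sum_eq_zero fun β hβ => by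
        rw [ih β (Finset.mem_range.mp hβ), zero_mul], zero_add] at h1
      have h2 : ∑' β : ℕ, c (β + α) * Complex.exp (-(β : ℂ) * t) =
          Complex.exp (-((Complex.I * k - α) * t)) *
            ∑' β : ℕ, c (β + α) * Complex.exp ((Complex.I * k - (β + α : ℕ)) * t) := by
        rw [← tsum_mul_left]
        refine tsum_congr fun β => ?_
        rw [mul_left_comm, ← Complex.exp_add]
        congr 2
        push_cast
        ring
      rw [h2, h1, mul_zero]
    rw [tsum_ite_eq] at hlim
    exact tendsto_nhds_unique (hlim.congr' hzero) tendsto_const_nhds |>.symm ▸ rfl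

/-- Cauchy product of the coefficient sequences. -/
def cauchyProd (p d : ℕ → ℂ) (α : ℕ) : ℂ := ∑ β ∈ Finset.range (α + 1), p (α - β) * d β

lemma cauchyProd_mul_exp (p d : ℕ → ℂ) (k : ℂ) (t : ℝ) (α : ℕ) :
    ∑ β ∈ Finset.range (α + 1), d β * Complex.exp ((Complex.I * k - β) * t) *
        (p (α - β) * Complex.exp (-((α - β : ℕ) : ℂ) * t)) =
      cauchyProd p d α * Complex.exp ((Complex.I * k - α) * t) := by
  rw [cauchyProd, Finset.sum_mul]
  refine Finset.sum_congr rfl fun β hβ => ?_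
  have h : Complex.exp ((Complex.I * k - α) * t) = Complex.exp ((Complex.I * k - β) * t) *
      Complex.exp (-((α - β : ℕ) : ℂ) * t) := by
    rw [← Complex.exp_add, Nat.cast_sub (by simpa [Nat.lt_succ_iff] using hβ)]
    congr 1
    ring
  rw [h]
  ring

lemma summable_norm_exp_series {p : ℕ → ℂ} (hp : Summable fun n => ‖p n‖) {t : ℝ} (ht : 0 < t) :
    Summable fun n : ℕ => ‖p n * Complex.exp (-(n : ℂ) * t)‖ := by
  have := summable_norm_expSum_term (ExpSummable.of_summable_norm hp) 0 ht
  simpa using this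

lemma ExpSummable.cauchyProd {p d : ℕ → ℂ} (hp : Summable fun n => ‖p n‖) (hd : ExpSummable d) :
    ExpSummable (cauchyProd p d) := by
  intro t ht
  have := summable_norm_sum_mul_range_of_summable_norm (summable_norm_expSum_term hd 0 ht)
    (summable_norm_exp_series hp ht)
  refine this.congr fun α => ?_
  rw [cauchyProd_mul_exp, norm_mul, norm_exp_exponent]
  simp

lemma expSum_cauchyProd {p d : ℕ → ℂ} (hp : Summable fun n => ‖p n‖) (hd : ExpSummable d) (k : ℂ)
    {t : ℝ} (ht : 0 < t) : expSum (cauchyProd p d) k t =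
      (∑' n : ℕ, p n * Complex.exp (-(n : ℂ) * t)) * expSum d k t := by
  rw [mul_comm]
  unfold expSum
  rw [tsum_mul_tsum_eq_tsum_sum_range_of_summable_norm (summable_norm_expSum_term hd k ht)
    (summable_norm_exp_series hp ht)]
  exact tsum_congr fun α => (cauchyProd_mul_exp p d k t α).symm

/-! ### The differential equation as a recursion -/

/-- `p` are the coefficients of the exponential series of `Q`, with the convention
`p_{γ 0} = 0`. Only the absolute summability of `n ↦ p_{γ n}` is recorded, since the weights
`n^γ` play no role. -/
structure IsExpansion (m : ℕ) (Q : ℕ → ℝ → ℂ) (p : ℕ → ℕ → ℂ) : Prop where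
  zero : ∀ γ, p γ 0 = 0
  summable : ∀ γ ∈ Finset.range (2 * m - 1), Summable fun n => ‖p γ n‖
  eq : ∀ γ ∈ Finset.range (2 * m - 1), ∀ t : ℝ, 0 ≤ t →
    Q γ t = (-1) ^ m * (-Complex.I) ^ γ * ∑' n : ℕ, p γ n * Complex.exp (-(n : ℂ) * t)

lemma InClass.exists_isExpansion {m : ℕ} {Q : ℕ → ℝ → ℂ} (hQ : InClass m Q) :
    ∃ p, IsExpansion m Q p := by
  obtain ⟨p, hp, hQp⟩ := hQ
  have hs : ∀ γ ∈ Finset.range (2 * m - 1), Summable fun n : ℕ => ‖p γ (n + 1)‖ := by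
    intro γ hγ
    refine Summable.of_nonneg_of_le (fun n => norm_nonneg _) (fun n => ?_) (hp γ hγ)
    refine le_mul_of_one_le_left (norm_nonneg _) (one_le_pow₀ ?_)
    exact_mod_cast Nat.le_add_left 1 n
  refine ⟨fun γ n => if n = 0 then 0 else p γ n, fun γ => by simp, fun γ hγ => ?_,
    fun γ hγ t ht => ?_⟩
  · exact (summable_nat_add_iff 1).mp (by simpa using hs γ hγ)
  · rw [hQp γ hγ t ht]
    congr 1
    rw [Summable.tsum_eq_zero_add (f := fun n : ℕ => (if n = 0 then 0 else p γ n) * _)]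
    · simp
    · refine (summable_nat_add_iff 1).mp (Summable.of_norm ?_)
      refine Summable.of_nonneg_of_le (fun n => norm_nonneg _) (fun n => ?_) (hs γ hγ)
      rw [if_neg (by omega), norm_mul]
      refine mul_le_of_le_one_right (norm_nonneg _) ?_
      rw [Complex.norm_exp, Real.exp_le_one_iff]
      simp only [Complex.mul_re, Complex.neg_re, Complex.natCast_re, Complex.ofReal_re,
        Complex.neg_im, Complex.natCast_im, Complex.ofReal_im]
      have : (0 : ℝ) ≤ ((n + 1 : ℕ) : ℝ) * t := by positivity
      linarith

/-- `∑_γ p_{γ s} z^γ`: the symbol of the part of the perturbation that carries `e^{-st}`. -/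
def symbol (m : ℕ) (p : ℕ → ℕ → ℂ) (s : ℕ) (z : ℂ) : ℂ :=
  ∑ γ ∈ Finset.range (2 * m - 1), p γ s * z ^ γ

/-- The coefficient of `e^{(ik - α)t}` that the differential equation produces from the exponential
sum with coefficients `c`; the sum solves the equation when all these numbers vanish. -/
def defect (m : ℕ) (p : ℕ → ℕ → ℂ) (k : ℂ) (c : ℕ → ℂ) (α : ℕ) : ℂ :=
  charDiff m α k * c α +
    (-1) ^ m * ∑ β ∈ Finset.range α, symbol m p (α - β) (k + Complex.I * β) * c β

lemma defect_eq {m : ℕ} {Q : ℕ → ℝ → ℂ} {p : ℕ → ℕ → ℂ} (hp : IsExpansion m Q p) (k : ℂ)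
    (c : ℕ → ℂ) (α : ℕ) : defect m p k c α =
      (-1) ^ m * ((Complex.I * k - α) ^ (2 * m) * c α) +
        (∑ γ ∈ Finset.range (2 * m - 1), (-1) ^ m * (-Complex.I) ^ γ *
          cauchyProd (p γ) (fun β => (Complex.I * k - β) ^ γ * c β) α) + -k ^ (2 * m) * c α := by
  have hrot : ∀ β : ℕ, Complex.I * k - β = Complex.I * (k + Complex.I * β) := by
    intro β
    linear_combination -(β : ℂ) * Complex.I_mul_I
  have h1 : (Complex.I * k - α) ^ (2 * m) = (-1) ^ m * (k + Complex.I * α) ^ (2 * m) := by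
    rw [hrot, mul_pow, pow_mul, Complex.I_sq]
  have h2 : ((-1 : ℂ) ^ m) * (-1) ^ m = 1 := by rw [← mul_pow]; simp
  have h3 : ∀ γ : ℕ, (-Complex.I) ^ γ * Complex.I ^ γ = 1 := fun γ => by
    rw [← mul_pow]; simp
  have h4 : ∀ γ ∈ Finset.range (2 * m - 1), (-1) ^ m * (-Complex.I) ^ γ *
      cauchyProd (p γ) (fun β => (Complex.I * k - β) ^ γ * c β) α =
      (-1) ^ m * ∑ β ∈ Finset.range α, p γ (α - β) * (k + Complex.I * β) ^ γ * c β := by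
    intro γ _
    rw [cauchyProd, Finset.sum_range_succ, Nat.sub_self, hp.zero, zero_mul, add_zero, mul_assoc,
      Finset.mul_sum]
    congr 1
    refine Finset.sum_congr rfl fun β _ => ?_
    rw [hrot, mul_pow]
    linear_combination (p γ (α - β) * (k + Complex.I * β) ^ γ * c β) * h3 γ
  rw [Finset.sum_congr rfl h4, ← Finset.mul_sum, Finset.sum_comm, h1, defect, charDiff]
  simp only [symbol, Finset.sum_mul]
  linear_combination -((k + Complex.I * α) ^ (2 * m) * c α) * h2

lemma expSummable_defect {m : ℕ} {Q : ℕ → ℝ → ℂ} {p : ℕ → ℕ → ℂ} (hp : IsExpansion m Q p) {k : ℂ}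
    {c : ℕ → ℂ} (hc : ExpSummable c) : ExpSummable (defect m p k c) := by
  rw [funext (defect_eq hp k c)]
  exact (((hc.exponent_pow_mul k _).const_mul _).add (ExpSummable.sum fun γ hγ =>
    (ExpSummable.cauchyProd (hp.summable γ hγ) (hc.exponent_pow_mul k γ)).const_mul _)).add
      (hc.const_mul _)

lemma expSum_defect {m : ℕ} {Q : ℕ → ℝ → ℂ} {p : ℕ → ℕ → ℂ} (hp : IsExpansion m Q p) (k : ℂ)
    {c : ℕ → ℂ} (hc : ExpSummable c) {t : ℝ} (ht : 0 < t) :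
    expSum (defect m p k c) k t = (-1) ^ m * iteratedDeriv (2 * m) (expSum c k) t
      + ∑ γ ∈ Finset.range (2 * m - 1), Q γ t * iteratedDeriv γ (expSum c k) t
      - k ^ (2 * m) * expSum c k t := by
  have hcauchy := fun γ hγ =>
    (ExpSummable.cauchyProd (hp.summable γ hγ) (hc.exponent_pow_mul k γ)).const_mul
      ((-1) ^ m * (-Complex.I) ^ γ)
  have hlead := (hc.exponent_pow_mul k (2 * m)).const_mul ((-1) ^ m)
  rw [funext (defect_eq hp k c), expSum_add (hlead.add (ExpSummable.sum hcauchy)) (hc.const_mul _)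
    k ht, expSum_add hlead (ExpSummable.sum hcauchy) k ht, expSum_sum hcauchy k ht,
    expSum_const_mul, expSum_const_mul, iteratedDeriv_expSum hc k _ ht, sub_eq_add_neg, neg_mul]
  congr 2
  refine Finset.sum_congr rfl fun γ hγ => ?_
  rw [expSum_const_mul, expSum_cauchyProd (hp.summable γ hγ) (hc.exponent_pow_mul k γ) k ht,
    hp.eq γ hγ t ht.le, iteratedDeriv_expSum hc k _ ht]
  ring

/-- An exponential sum solves the equation exactly when its coefficients satisfy the recursion. -/
lemma isSolution_expSum_iff {m : ℕ} {Q : ℕ → ℝ → ℂ} {p : ℕ → ℕ → ℂ} (hp : IsExpansion m Q p)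
    {k : ℂ} {c : ℕ → ℂ} (hc : ExpSummable c) :
    IsSolution m Q k (expSum c k) ↔ ∀ α, defect m p k c α = 0 := by
  constructor
  · rintro ⟨-, h⟩
    refine eq_zero_of_expSum_eq_zero (expSummable_defect hp hc) k fun t ht => ?_
    rw [expSum_defect hp k hc ht, h t ht, sub_self]
  · intro h
    refine ⟨contDiffOn_expSum hc k _, fun t ht => ?_⟩
    rw [← sub_eq_zero, ← expSum_defect hp k hc ht]
    simp [expSum, h]

/-! ### Decay of solutions of the recursion -/

lemma le_of_quadratic_recursion {x a : ℕ → ℝ} (hx : ∀ α, 0 ≤ x α) (ha : ∀ s, 0 ≤ a s) {K A B : ℝ}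
    {N : ℕ} (hK : 0 ≤ K) (hA : ∀ α, ∑ β ∈ Finset.range α, a (α - β) ≤ A) (hN : K * A ≤ N ^ 2)
    (hB : ∀ β ≤ N, x β ≤ B)
    (hrec : ∀ α, N < α → x α * α ^ 2 ≤ K * ∑ β ∈ Finset.range α, a (α - β) * x β) (α : ℕ) :
    x α ≤ 4 * B * (N + 1) ^ 2 / (α + 1) ^ 2 := by
  have hB0 : 0 ≤ B := (hx 0).trans (hB 0 (Nat.zero_le N))
  have hstep : ∀ α, N < α → (∀ β < α, x β ≤ B) → x α * α ^ 2 ≤ N ^ 2 * B := by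
    intro α hα hlt
    calc x α * α ^ 2 ≤ K * ∑ β ∈ Finset.range α, a (α - β) * x β := hrec α hα
      _ ≤ K * ∑ β ∈ Finset.range α, a (α - β) * B := by
          gcongr with β hβ
          · exact ha _
          · exact hlt β (Finset.mem_range.mp hβ)
      _ = K * (∑ β ∈ Finset.range α, a (α - β)) * B := by rw [← Finset.sum_mul, mul_assoc]
      _ ≤ K * A * B := by gcongr; exact hA α
      _ ≤ N ^ 2 * B := by gcongr
  have hbdd : ∀ α, x α ≤ B := by
    intro α
    induction α using Nat.strong_induction_on with
    | _ α ih =>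
      rcases le_or_gt α N with h | h
      · exact hB α h
      · have hα : (0 : ℝ) < (α : ℝ) ^ 2 := by
          have : 0 < α := by omega
          positivity
        refine le_of_mul_le_mul_right ((hstep α h ih).trans ?_) hα
        rw [mul_comm]
        gcongr
  rw [le_div_iff₀ (by positivity)]
  rcases le_or_gt α N with h | h
  · calc x α * (α + 1) ^ 2 ≤ B * (N + 1) ^ 2 := by
          gcongr
          exact hbdd α
      _ ≤ 4 * B * (N + 1) ^ 2 := by
          have : 0 ≤ B * ((N : ℝ) + 1) ^ 2 := by positivity
          linarith
  · have h1 : (1 : ℝ) ≤ α := by exact_mod_cast (by omega : 1 ≤ α)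
    calc x α * (α + 1) ^ 2 ≤ x α * (2 * α) ^ 2 := by
          gcongr
          · exact hx α
          · linarith
      _ = 4 * (x α * α ^ 2) := by ring
      _ ≤ 4 * (N ^ 2 * B) := by
          have := hstep α h fun β _ => hbdd β
          linarith
      _ = 4 * B * N ^ 2 := by ring
      _ ≤ 4 * B * (N + 1) ^ 2 := by gcongr; linarith

lemma norm_symbol_le (m : ℕ) (p : ℕ → ℕ → ℂ) (s : ℕ) {z : ℂ} {Z : ℝ} (hz : ‖z‖ ≤ Z) (hZ : 1 ≤ Z) :
    ‖symbol m p s z‖ ≤ (∑ γ ∈ Finset.range (2 * m - 1), ‖p γ s‖) * Z ^ (2 * m - 2) := by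
  rw [symbol, Finset.sum_mul]
  refine (norm_sum_le _ _).trans (Finset.sum_le_sum fun γ hγ => ?_)
  rw [norm_mul, norm_pow]
  gcongr
  calc ‖z‖ ^ γ ≤ Z ^ γ := by gcongr
    _ ≤ Z ^ (2 * m - 2) := by
      refine pow_le_pow_right₀ hZ ?_
      rw [Finset.mem_range] at hγ
      omega

lemma le_norm_charDiff {m : ℕ} (hm : 1 ≤ m) {α : ℕ} {k : ℂ} {R : ℝ} (hk : ‖k‖ ≤ R)
    (hα : 4 * R ≤ α) : ((α : ℝ) / 2) ^ (2 * m) ≤ ‖charDiff m α k‖ := by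
  have hR : 0 ≤ R := (norm_nonneg k).trans hk
  have h1 : (α : ℝ) - R ≤ ‖k + Complex.I * α‖ := by
    have := norm_sub_norm_le (Complex.I * α) (-k)
    simp only [norm_mul, Complex.norm_I, Complex.norm_natCast, one_mul, norm_neg, sub_neg_eq_add]
      at this
    rw [add_comm]
    linarith
  have h2 : ((α : ℝ) / 2) ^ (2 * m) + R ^ (2 * m) ≤ (α - R) ^ (2 * m) := by
    refine (pow_add_pow_le (by positivity) hR (by omega)).trans ?_
    gcongr
    linarith
  calc ((α : ℝ) / 2) ^ (2 * m) ≤ (α - R) ^ (2 * m) - R ^ (2 * m) := by linarith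
    _ ≤ ‖k + Complex.I * α‖ ^ (2 * m) - ‖k‖ ^ (2 * m) := by
        gcongr
        linarith
    _ ≤ ‖charDiff m α k‖ := by
        rw [charDiff, ← norm_pow, ← norm_pow]
        exact norm_sub_norm_le _ _

/-- Solutions of the recursion decay like `α⁻²`, since `|(k + iα)^{2m} - k^{2m}|` grows like
`α^{2m}` while the symbols have degree at most `2m - 2`. The bound depends only on finitely many
initial terms, uniformly for bounded `k`; this uniformity is what allows passing to the limit
`k → k_{nj}` term by term. -/
lemma exists_uniform_decay {m : ℕ} (hm : 1 ≤ m) {Q : ℕ → ℝ → ℂ} {p : ℕ → ℕ → ℂ}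
    (hp : IsExpansion m Q p) (R : ℝ) : ∃ N : ℕ, ∀ k : ℂ, ‖k‖ ≤ R → ∀ x : ℕ → ℂ,
      (∀ α, N < α → defect m p k x α = 0) → ∀ B : ℝ, (∀ β ≤ N, ‖x β‖ ≤ B) →
        ∀ α : ℕ, ‖x α‖ ≤ 4 * B * (N + 1) ^ 2 / (α + 1) ^ 2 := by
  set a : ℕ → ℝ := fun s => ∑ γ ∈ Finset.range (2 * m - 1), ‖p γ s‖ with ha_def
  have ha : ∀ s, 0 ≤ a s := fun s => Finset.sum_nonneg fun γ _ => norm_nonneg _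
  have hsum : Summable a := summable_sum hp.summable
  have hA : ∀ α, ∑ β ∈ Finset.range α, a (α - β) ≤ ∑' s, a s := by
    intro α
    have h1 : ∑ β ∈ Finset.range α, a (α - β) = ∑ s ∈ Finset.range α, a (s + 1) := by
      rw [← Finset.sum_range_reflect]
      refine Finset.sum_congr rfl fun β hβ => ?_
      rw [Finset.mem_range] at hβ
      congr 1
      omega
    have h2 := hsum.sum_le_tsum (Finset.range (α + 1)) fun s _ => ha s
    rw [Finset.sum_range_succ'] at h2
    rw [h1]
    linarith [ha 0]
  obtain ⟨r, hr⟩ : ∃ r, 2 * m = r + 2 := ⟨2 * m - 2, by omega⟩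
  set K : ℝ := 2 ^ r * 2 ^ (r + 2) with hK_def
  obtain ⟨N, hN⟩ := exists_nat_ge (max (4 * R) (max 1 (K * ∑' s, a s)))
  have hN1 : 4 * R ≤ N := (le_max_left _ _).trans hN
  have hN2 : (1 : ℝ) ≤ N := ((le_max_left _ _).trans (le_max_right _ _)).trans hN
  have hN3 : K * ∑' s, a s ≤ (N : ℝ) ^ 2 := by
    have : K * ∑' s, a s ≤ N := ((le_max_right _ _).trans (le_max_right _ _)).trans hN
    nlinarith
  refine ⟨N, fun k hk x hx B hB => le_of_quadratic_recursion (x := fun α => ‖x α‖)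
    (fun α => norm_nonneg _) ha (by positivity) hA hN3 hB fun α hα => ?_⟩
  have hαN : (N : ℝ) ≤ α := by exact_mod_cast hα.le
  have hα0 : (0 : ℝ) < (α : ℝ) ^ r := by
    have : (0 : ℝ) < α := by linarith
    positivity
  have h1 : charDiff m α k * x α =
      -((-1) ^ m * ∑ β ∈ Finset.range α, symbol m p (α - β) (k + Complex.I * β) * x β) :=
    eq_neg_of_add_eq_zero_left (hx α hα)
  have h2 : ‖charDiff m α k‖ * ‖x α‖ ≤
      ∑ β ∈ Finset.range α, a (α - β) * (2 * α) ^ r * ‖x β‖ := by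
    rw [← norm_mul, h1, norm_neg, norm_mul, norm_pow, norm_neg, norm_one, one_pow, one_mul]
    refine (norm_sum_le _ _).trans (Finset.sum_le_sum fun β hβ => ?_)
    rw [norm_mul]
    gcongr
    have h3 := norm_symbol_le m p (α - β) (z := k + Complex.I * β) (Z := 2 * α) ?_ (by linarith)
    · have hr' : 2 * m - 2 = r := by omega
      rwa [hr'] at h3
    · refine (norm_add_le _ _).trans ?_
      have : (β : ℝ) ≤ α := by exact_mod_cast (Finset.mem_range.mp hβ).le
      simp only [norm_mul, Complex.norm_I, Complex.norm_natCast, one_mul]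
      linarith [norm_nonneg k]
  have h4 := le_norm_charDiff hm hk (hN1.trans hαN)
  have h5 : ((α : ℝ) / 2) ^ (r + 2) * ‖x α‖ ≤
      ∑ β ∈ Finset.range α, a (α - β) * (2 * α) ^ r * ‖x β‖ := by
    rw [hr] at h4
    exact le_trans (by gcongr) h2
  refine le_of_mul_le_mul_right ?_ hα0
  calc ‖x α‖ * α ^ 2 * α ^ r = 2 ^ (r + 2) * (((α : ℝ) / 2) ^ (r + 2) * ‖x α‖) := by
        rw [div_pow]
        field_simp
        ring
    _ ≤ 2 ^ (r + 2) * ∑ β ∈ Finset.range α, a (α - β) * (2 * α) ^ r * ‖x β‖ := by gcongr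
    _ = K * (∑ β ∈ Finset.range α, a (α - β) * ‖x β‖) * α ^ r := by
        rw [Finset.mul_sum, Finset.mul_sum, Finset.sum_mul]
        refine Finset.sum_congr rfl fun β _ => ?_
        rw [mul_pow]
        ring

lemma summable_const_div_succ_sq (C : ℝ) : Summable fun α : ℕ => C / ((α : ℝ) + 1) ^ 2 := by
  have h := (summable_nat_add_iff 1).mpr (Real.summable_one_div_nat_pow.mpr one_lt_two)
  refine (h.mul_left C).congr fun α => ?_
  push_cast
  ring

/-- A solution of the recursion is absolutely summable. -/
lemma summable_norm_of_defect_eq_zero {m : ℕ} (hm : 1 ≤ m) {Q : ℕ → ℝ → ℂ} {p : ℕ → ℕ → ℂ}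
    (hp : IsExpansion m Q p) {k : ℂ} {x : ℕ → ℂ} (hx : ∀ α, defect m p k x α = 0) :
    Summable fun α => ‖x α‖ := by
  obtain ⟨N, hN⟩ := exists_uniform_decay hm hp ‖k‖
  refine Summable.of_nonneg_of_le (fun α => norm_nonneg _)
    (hN k le_rfl x (fun α _ => hx α) (∑ β ∈ Finset.range (N + 1), ‖x β‖) fun β hβ => ?_)
    (summable_const_div_succ_sq _)
  exact Finset.single_le_sum (f := fun β => ‖x β‖) (fun _ _ => norm_nonneg _)
    (Finset.mem_range.mpr (by omega))

/-! ### Partial fractions and existence of the solution `f(t, k)` -/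

/-- The coefficient of `e^{(ik - α)t}` in `f(t, k)`, including the leading coefficient `1`. -/
def solCoeff (m : ℕ) (V : ℕ → ℕ → ℕ → ℂ) (k : ℂ) (α : ℕ) : ℂ :=
  if α = 0 then 1 else ∑ j ∈ Finset.Icc 1 (2 * m - 1), ∑ n ∈ Finset.Icc 1 α,
    V j n α / (Complex.I * n + k * (1 - omega m j))

lemma solCoeff_zero (m : ℕ) (V : ℕ → ℕ → ℕ → ℂ) (k : ℂ) : solCoeff m V k 0 = 1 := if_pos rfl

/-- Away from the points `k_{nj}`, `g` is a combination of the fractions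
`1 / (i n + k (1 - ω_j))` with `1 ≤ n ≤ α`. -/
def IsPartialFraction (m α : ℕ) (g : ℂ → ℂ) : Prop :=
  ∃ v : ℕ → ℕ → ℂ, ∀ k, IsRegularPoint m k →
    g k = ∑ j ∈ Finset.Icc 1 (2 * m - 1), ∑ n ∈ Finset.Icc 1 α,
      v j n / (Complex.I * n + k * (1 - omega m j))

lemma IsPartialFraction.congr {m α : ℕ} {g h : ℂ → ℂ} (hg : IsPartialFraction m α g)
    (hgh : ∀ k, IsRegularPoint m k → h k = g k) : IsPartialFraction m α h := by
  obtain ⟨v, hv⟩ := hg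
  exact ⟨v, fun k hk => (hgh k hk).trans (hv k hk)⟩

lemma IsPartialFraction.const_mul {m α : ℕ} {g : ℂ → ℂ} (hg : IsPartialFraction m α g) (a : ℂ) :
    IsPartialFraction m α fun k => a * g k := by
  obtain ⟨v, hv⟩ := hg
  refine ⟨fun j n => a * v j n, fun k hk => ?_⟩
  simp only [hv k hk, Finset.mul_sum, mul_div_assoc]

lemma IsPartialFraction.sum {m α : ℕ} {ι : Type*} {s : Finset ι} {g : ι → ℂ → ℂ}
    (hg : ∀ i ∈ s, IsPartialFraction m α (g i)) :
    IsPartialFraction m α fun k => ∑ i ∈ s, g i k := by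
  classical
  induction s using Finset.induction_on with
  | empty => exact ⟨fun _ _ => 0, fun k _ => by simp⟩
  | insert a s ha ih =>
    obtain ⟨v, hv⟩ := hg a (by simp)
    obtain ⟨w, hw⟩ := ih fun i hi => hg i (by simp [hi])
    refine ⟨fun j n => v j n + w j n, fun k hk => ?_⟩
    simp only [Finset.sum_insert ha, hv k hk, hw k hk, add_div, Finset.sum_add_distrib]

lemma isPartialFraction_single {m α n j : ℕ} (hn : n ∈ Finset.Icc 1 α)
    (hj : j ∈ Finset.Icc 1 (2 * m - 1)) (a : ℂ) :
    IsPartialFraction m α fun k => a / (Complex.I * n + k * (1 - omega m j)) := by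
  refine ⟨fun j' n' => if j' = j then if n' = n then a else 0 else 0, fun k _ => ?_⟩
  rw [Finset.sum_eq_single_of_mem j hj fun j' _ h => by simp [h],
    Finset.sum_eq_single_of_mem n hn fun n' _ h => by simp [h]]
  simp

/-- A proper fraction whose denominator is a product of distinct linear factors has a partial
fraction decomposition with simple poles, by Lagrange interpolation of the numerator. -/
lemma isPartialFraction_div_prod {m α : ℕ} {s : Finset (ℕ × ℕ)}
    (hs : s ⊆ Finset.Icc 1 α ×ˢ Finset.Icc 1 (2 * m - 1)) {T : Polynomial ℂ}
    (hT : T.degree < s.card) :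
    IsPartialFraction m α fun k =>
      T.eval k / ∏ x ∈ s, (Complex.I * x.1 + k * (1 - omega m x.2)) := by
  have hmem : ∀ x ∈ s, x.1 ∈ Finset.Icc 1 α ∧ x.2 ∈ Finset.Icc 1 (2 * m - 1) := fun x hx =>
    Finset.mem_product.mp (hs hx)
  have hinj : Set.InjOn (fun x : ℕ × ℕ => pole m x.1 x.2) s := by
    intro x hx y hy hxy
    have h := pole_inj (Finset.mem_Icc.mp (hmem x hx).1).1 (hmem x hx).2 (hmem y hy).2 hxy
    exact Prod.ext h.1 h.2
  set C : ℂ := ∏ x ∈ s, (1 - omega m x.2)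
  set w := Lagrange.nodalWeight s (fun x : ℕ × ℕ => pole m x.1 x.2)
  refine IsPartialFraction.congr (IsPartialFraction.sum (s := s) (g := fun x k =>
    (C⁻¹ * (w x * T.eval (pole m x.1 x.2)) * (1 - omega m x.2)) /
      (Complex.I * x.1 + k * (1 - omega m x.2)))
    fun x hx => isPartialFraction_single (hmem x hx).1 (hmem x hx).2 _) fun k hk => ?_
  have hne : ∀ x ∈ s, k ≠ pole m x.1 x.2 := fun x hx =>
    hk x.1 (Finset.mem_Icc.mp (hmem x hx).1).1 x.2 (hmem x hx).2
  have h1 : T.eval k = (∏ x ∈ s, (k - pole m x.1 x.2)) *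
      ∑ x ∈ s, w x * (k - pole m x.1 x.2)⁻¹ * T.eval (pole m x.1 x.2) := by
    conv_lhs => rw [Lagrange.eq_interpolate hinj hT]
    rw [Lagrange.eval_interpolate_not_at_node _ hne, Lagrange.eval_nodal]
  have h2 : ∏ x ∈ s, (Complex.I * x.1 + k * (1 - omega m x.2)) =
      C * ∏ x ∈ s, (k - pole m x.1 x.2) := by
    rw [← Finset.prod_mul_distrib]
    exact Finset.prod_congr rfl fun x hx => linear_factor_eq (hmem x hx).2 k
  have h3 : ∏ x ∈ s, (k - pole m x.1 x.2) ≠ 0 :=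
    Finset.prod_ne_zero_iff.mpr fun x hx => sub_ne_zero.mpr (hne x hx)
  rw [h1, h2, mul_comm C, mul_div_mul_left _ _ h3, Finset.sum_div]
  refine Finset.sum_congr rfl fun x hx => ?_
  have h4 := one_sub_omega_ne_zero (hmem x hx).2
  rw [linear_factor_eq (hmem x hx).2, mul_comm _ (1 - omega m x.2), mul_div_mul_left _ _ h4]
  ring

lemma exists_polynomial_symbol (m : ℕ) (p : ℕ → ℕ → ℂ) (s : ℕ) (z : ℂ) :
    ∃ T : Polynomial ℂ, T.degree < ((2 * m - 1 : ℕ) : WithBot ℕ) ∧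
      ∀ k, T.eval k = symbol m p s (k + z) := by
  refine ⟨∑ γ ∈ Finset.range (2 * m - 1),
    Polynomial.C (p γ s) * (Polynomial.X + Polynomial.C z) ^ γ, ?_, fun k => ?_⟩
  · refine (Polynomial.degree_sum_le _ _).trans_lt ?_
    rw [Finset.sup_lt_iff (WithBot.bot_lt_coe _)]
    intro γ hγ
    rw [Polynomial.degree_mul, Polynomial.degree_pow, Polynomial.degree_X_add_C, nsmul_one]
    refine (add_le_add_left Polynomial.degree_C_le _).trans_lt ?_
    rw [zero_add]
    exact_mod_cast Finset.mem_range.mp hγ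
  · simp [symbol, Polynomial.eval_finsetSum]

lemma isPartialFraction_symbol_div_charDiff {m α : ℕ} (hm : 1 ≤ m) (hα : 1 ≤ α) (p : ℕ → ℕ → ℂ)
    (s : ℕ) (z : ℂ) :
    IsPartialFraction m α fun k => symbol m p s (k + z) / charDiff m α k := by
  obtain ⟨T, hT, hTs⟩ := exists_polynomial_symbol m p s z
  have h := isPartialFraction_div_prod (m := m) (α := α) (T := T)
    (s := {α} ×ˢ Finset.Icc 1 (2 * m - 1)) (by
      refine Finset.product_subset_product_left ?_
      simpa using hα) (by simpa using hT)
  refine (h.const_mul (Complex.I * α)⁻¹).congr fun k _ => ?_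
  rw [charDiff_eq_prod hm, Finset.prod_product, Finset.prod_singleton, hTs]
  field_simp

/-- An additional factor with `n < α` keeps the poles simple: the zeros of the denominators for
`n` and for `α` lie on different horizontal lines. -/
lemma isPartialFraction_symbol_div_charDiff_mul {m α n j : ℕ} (hm : 1 ≤ m)
    (hn : 1 ≤ n) (hnα : n < α) (hj : j ∈ Finset.Icc 1 (2 * m - 1)) (p : ℕ → ℕ → ℂ) (s : ℕ) (z : ℂ) :
    IsPartialFraction m α fun k => symbol m p s (k + z) / charDiff m α k *
      (1 / (Complex.I * n + k * (1 - omega m j))) := by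
  obtain ⟨T, hT, hTs⟩ := exists_polynomial_symbol m p s z
  have hnot : (n, j) ∉ ({α} : Finset ℕ) ×ˢ Finset.Icc 1 (2 * m - 1) := by
    simp only [Finset.mem_product, Finset.mem_singleton, not_and]
    intro h
    omega
  have h := isPartialFraction_div_prod (m := m) (α := α) (T := T)
    (s := insert (n, j) (({α} : Finset ℕ) ×ˢ Finset.Icc 1 (2 * m - 1))) (by
      refine Finset.insert_subset ?_ (Finset.product_subset_product_left ?_)
      · exact Finset.mem_product.mpr ⟨Finset.mem_Icc.mpr ⟨hn, hnα.le⟩, hj⟩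
      · simp
        omega) (by
      rw [Finset.card_insert_of_notMem hnot]
      refine hT.trans ?_
      simp
      norm_cast
      omega)
  refine (h.const_mul (Complex.I * α)⁻¹).congr fun k _ => ?_
  rw [charDiff_eq_prod hm, Finset.prod_insert hnot, Finset.prod_product, Finset.prod_singleton, hTs]
  field_simp

/-- The solution of the recursion `defect m p k c = 0` with `c 0 = 1`. -/
def recCoeff (m : ℕ) (p : ℕ → ℕ → ℂ) (k : ℂ) : ℕ → ℂ
  | 0 => 1
  | α + 1 => -(-1) ^ m * ∑ β : Fin (α + 1),
      symbol m p (α + 1 - β) (k + Complex.I * β) / charDiff m (α + 1) k * recCoeff m p k β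

lemma recCoeff_eq {m : ℕ} (p : ℕ → ℕ → ℂ) (k : ℂ) {α : ℕ} (hα : 1 ≤ α) :
    recCoeff m p k α = -(-1) ^ m * ∑ β ∈ Finset.range α,
      symbol m p (α - β) (k + Complex.I * β) / charDiff m α k * recCoeff m p k β := by
  obtain ⟨a, rfl⟩ : ∃ a, α = a + 1 := ⟨α - 1, by omega⟩
  rw [recCoeff, Finset.sum_range]

lemma defect_zero (m : ℕ) (p : ℕ → ℕ → ℂ) (k : ℂ) (c : ℕ → ℂ) : defect m p k c 0 = 0 := by
  simp [defect, charDiff]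

lemma defect_recCoeff {m : ℕ} (hm : 1 ≤ m) (p : ℕ → ℕ → ℂ) {k : ℂ} (hk : IsRegularPoint m k)
    (α : ℕ) : defect m p k (recCoeff m p k) α = 0 := by
  rcases Nat.eq_zero_or_pos α with rfl | hα
  · exact defect_zero m p k _
  · rw [defect, recCoeff_eq p k hα]
    have h := charDiff_ne_zero hm hα hk
    rw [Finset.mul_sum, Finset.mul_sum, Finset.mul_sum, ← Finset.sum_add_distrib]
    refine Finset.sum_eq_zero fun β _ => ?_
    field_simp
    ring

/-- The recursion determines the coefficients up to the leading one. -/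
lemma eq_mul_of_defect_eq_zero {m : ℕ} (hm : 1 ≤ m) {p : ℕ → ℕ → ℂ} {k : ℂ}
    (hk : IsRegularPoint m k) {x c : ℕ → ℂ} (hx : ∀ α, defect m p k x α = 0)
    (hc : ∀ α, defect m p k c α = 0) (hc0 : c 0 = 1) (α : ℕ) : x α = x 0 * c α := by
  induction α using Nat.strong_induction_on with
  | _ α ih =>
    rcases Nat.eq_zero_or_pos α with rfl | hα
    · rw [hc0, mul_one]
    · have h1 := hx α
      have h2 := hc α
      unfold defect at h1 h2
      rw [Finset.sum_congr rfl fun β hβ => by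
        rw [ih β (Finset.mem_range.mp hβ), mul_left_comm], ← Finset.mul_sum] at h1
      refine mul_left_cancel₀ (charDiff_ne_zero hm hα hk) ?_
      linear_combination h1 - x 0 * h2

lemma isPartialFraction_recCoeff {m : ℕ} (hm : 1 ≤ m) (p : ℕ → ℕ → ℂ) {α : ℕ} (hα : 1 ≤ α) :
    IsPartialFraction m α fun k => recCoeff m p k α := by
  induction α using Nat.strong_induction_on with
  | _ α ih =>
    have hterm : ∀ β ∈ Finset.range α, IsPartialFraction m α fun k =>
        symbol m p (α - β) (k + Complex.I * β) / charDiff m α k * recCoeff m p k β := by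
      intro β hβ
      rw [Finset.mem_range] at hβ
      rcases Nat.eq_zero_or_pos β with rfl | hβ0
      · exact (isPartialFraction_symbol_div_charDiff hm hα p _ _).congr fun k _ => by
          rw [recCoeff, mul_one]
      · obtain ⟨v, hv⟩ := ih β hβ hβ0
        refine IsPartialFraction.congr (IsPartialFraction.sum fun j hj =>
          IsPartialFraction.sum fun n hn =>
            (isPartialFraction_symbol_div_charDiff_mul hm (Finset.mem_Icc.mp hn).1
              ((Finset.mem_Icc.mp hn).2.trans_lt hβ) hj p (α - β)
              (Complex.I * β)).const_mul (v j n)) fun k hk => ?_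
        have hvk : recCoeff m p k β = _ := hv k hk
        rw [hvk, Finset.mul_sum]
        refine Finset.sum_congr rfl fun j _ => ?_
        rw [Finset.mul_sum]
        exact Finset.sum_congr rfl fun n _ => by ring
    exact ((IsPartialFraction.sum hterm).const_mul (-(-1) ^ m)).congr fun k _ => recCoeff_eq p k hα

lemma exists_defect_solCoeff_eq_zero {m : ℕ} (hm : 1 ≤ m) (p : ℕ → ℕ → ℂ) :
    ∃ V, ∀ k, IsRegularPoint m k → ∀ α, defect m p k (solCoeff m V k) α = 0 := by
  have h : ∀ α, ∃ v : ℕ → ℕ → ℂ, 1 ≤ α → ∀ k, IsRegularPoint m k →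
      recCoeff m p k α = ∑ j ∈ Finset.Icc 1 (2 * m - 1), ∑ n ∈ Finset.Icc 1 α,
        v j n / (Complex.I * n + k * (1 - omega m j)) := by
    intro α
    by_cases hα : 1 ≤ α
    · obtain ⟨v, hv⟩ := isPartialFraction_recCoeff hm p hα
      exact ⟨v, fun _ => hv⟩
    · exact ⟨0, fun h => absurd h hα⟩
  choose v hv using h
  refine ⟨fun j n α => v α j n, fun k hk α => ?_⟩
  have heq : solCoeff m (fun j n α => v α j n) k = recCoeff m p k := by
    funext α
    rcases Nat.eq_zero_or_pos α with rfl | hα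
    · rw [solCoeff_zero, recCoeff]
    · rw [solCoeff, if_neg (by omega), hv α hα k hk]
  rw [heq]
  exact defect_recCoeff hm p hk α

lemma solCoeff_succ_mul_exp (m : ℕ) (V : ℕ → ℕ → ℕ → ℂ) (k : ℂ) (t : ℝ) (a : ℕ) :
    solCoeff m V k (a + 1) * Complex.exp ((Complex.I * k - (a + 1 : ℕ)) * t) =
      seriesTerm m V t k (a + 1) := by
  rw [solCoeff, if_neg (by omega), seriesTerm]

lemma seriesSol_eq_expSum {m : ℕ} {V : ℕ → ℕ → ℕ → ℂ} {t : ℝ} {k : ℂ}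
    (h : Summable fun a : ℕ => seriesTerm m V t k (a + 1)) :
    seriesSol m V t k = expSum (solCoeff m V k) k t := by
  have hs : Summable fun α : ℕ => solCoeff m V k α * Complex.exp ((Complex.I * k - α) * t) :=
    (summable_nat_add_iff 1).mp (h.congr fun a => (solCoeff_succ_mul_exp m V k t a).symm)
  rw [expSum, hs.tsum_eq_zero_add, seriesSol, solCoeff_zero]
  simp only [solCoeff_succ_mul_exp, Nat.cast_zero, sub_zero, one_mul]

lemma summable_seriesTerm_iff {m : ℕ} {V : ℕ → ℕ → ℕ → ℂ} {k : ℂ} :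
    (∀ t : ℝ, 0 ≤ t → Summable fun a : ℕ => seriesTerm m V t k (a + 1)) ↔
      Summable fun α => ‖solCoeff m V k α‖ := by
  rw [← summable_nat_add_iff (f := fun α => ‖solCoeff m V k α‖) 1]
  constructor
  · intro h
    refine (h 0 le_rfl).norm.congr fun a => ?_
    rw [← solCoeff_succ_mul_exp]
    simp
  · intro h t ht
    refine Summable.of_norm (Summable.of_nonneg_of_le (fun a => norm_nonneg _) (fun a => ?_)
      (h.mul_left (Real.exp (-(k.im * t)))))
    rw [← solCoeff_succ_mul_exp, norm_mul, norm_exp_exponent]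
    have : Real.exp (-((a + 1 : ℕ) * t)) ≤ 1 := by
      rw [Real.exp_le_one_iff, neg_nonpos]
      positivity
    calc _ ≤ ‖solCoeff m V k (a + 1)‖ * (Real.exp (-(k.im * t)) * 1) := by gcongr
      _ = _ := by ring

/-- The numbers `V` yield solutions of the form `f(t, k)` exactly when the resulting coefficients
satisfy the recursion; the convergence at `t = 0` is then automatic. -/
lemma isSolutionSystem_iff {m : ℕ} (hm : 1 ≤ m) {Q : ℕ → ℝ → ℂ} {p : ℕ → ℕ → ℂ}
    (hp : IsExpansion m Q p) {V : ℕ → ℕ → ℕ → ℂ} : IsSolutionSystem m Q V ↔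
      ∀ k, IsRegularPoint m k → ∀ α, defect m p k (solCoeff m V k) α = 0 := by
  have key : ∀ k : ℂ, (∀ t : ℝ, 0 ≤ t → Summable fun a : ℕ => seriesTerm m V t k (a + 1)) →
      (IsSolution m Q k (fun t => seriesSol m V t k) ↔
        ∀ α, defect m p k (solCoeff m V k) α = 0) := by
    intro k hs
    rw [← isSolution_expSum_iff hp (ExpSummable.of_summable_norm (summable_seriesTerm_iff.mp hs))]
    have hev : ∀ t : ℝ, 0 < t → seriesSol m V t k = expSum (solCoeff m V k) k t :=
      fun t ht => seriesSol_eq_expSum (hs t ht.le)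
    have hder : ∀ γ : ℕ, ∀ t : ℝ, 0 < t → iteratedDeriv γ (fun t => seriesSol m V t k) t =
        iteratedDeriv γ (expSum (solCoeff m V k) k) t := by
      intro γ t ht
      refine Filter.EventuallyEq.iteratedDeriv_eq γ ?_
      filter_upwards [Ioi_mem_nhds ht] with s hs' using hev s hs'
    unfold IsSolution
    refine and_congr (contDiffOn_congr fun t ht => hev t ht) ?_
    refine forall_congr' fun t => forall_congr' fun ht => ?_
    simp only [hder _ t ht, hev t ht]
  refine forall_congr' fun k => forall_congr' fun hk => ?_
  constructor
  · rintro ⟨hs, hsol⟩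
    exact (key k hs).mp hsol
  · intro h
    have hs := summable_seriesTerm_iff.mpr (summable_norm_of_defect_eq_zero hm hp h)
    exact ⟨hs, (key k hs).mpr h⟩

/-! ### Residues at the points `k_{nj}` -/

lemma tendsto_linear_factor {m n j : ℕ} (hj : j ∈ Finset.Icc 1 (2 * m - 1)) :
    Tendsto (fun k : ℂ => Complex.I * n + k * (1 - omega m j)) (𝓝[≠] pole m n j) (𝓝 0) := by
  have h : Continuous fun k : ℂ => Complex.I * n + k * (1 - omega m j) := by fun_prop
  have h1 := (h.tendsto (pole m n j)).mono_left (nhdsWithin_le_nhds (s := {pole m n j}ᶜ))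
  rwa [linear_factor_eq hj, sub_self, mul_zero] at h1

lemma tendsto_linear_factor_mul_div {m n j n' j' : ℕ} (hn : 1 ≤ n)
    (hj : j ∈ Finset.Icc 1 (2 * m - 1)) (hj' : j' ∈ Finset.Icc 1 (2 * m - 1)) (a : ℂ) :
    Tendsto (fun k : ℂ => (Complex.I * n + k * (1 - omega m j)) *
      (a / (Complex.I * n' + k * (1 - omega m j')))) (𝓝[≠] pole m n j)
      (𝓝 (if j' = j then if n' = n then a else 0 else 0)) := by
  by_cases h : j' = j ∧ n' = n
  · obtain ⟨rfl, rfl⟩ := h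
    rw [if_pos rfl, if_pos rfl]
    refine tendsto_const_nhds.congr' ?_
    filter_upwards [self_mem_nhdsWithin] with k hk
    rw [mul_div_cancel₀ a (linear_factor_ne_zero hj hk)]
  · have h0 : (if j' = j then if n' = n then a else 0 else 0) = 0 := by
      rw [not_and] at h
      split_ifs with h1 h2
      · exact absurd h2 (h h1)
      · rfl
      · rfl
    have hne : pole m n j ≠ pole m n' j' := fun hp => by
      have := pole_inj hn hj hj' hp
      exact h ⟨this.2.symm, this.1.symm⟩
    have hcont : ContinuousAt (fun k : ℂ => a / (Complex.I * n' + k * (1 - omega m j')))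
        (pole m n j) := by
      refine ContinuousAt.div continuousAt_const ?_ (linear_factor_ne_zero hj' hne)
      fun_prop
    have := (tendsto_linear_factor hj).mul (hcont.tendsto.mono_left nhdsWithin_le_nhds)
    rwa [zero_mul, ← h0] at this

/-- The limit of `(i n + k (1 - ω_j)) c_α(k)` as `k → k_{nj}`, where `c_α` is the coefficient of
`e^{(ik - α)t}` in `f(t, k)`. -/
def residueCoeff (V : ℕ → ℕ → ℕ → ℂ) (n j α : ℕ) : ℂ := if n ≤ α then V j n α else 0

lemma tendsto_linear_factor_mul_solCoeff {m n j : ℕ} (hn : 1 ≤ n)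
    (hj : j ∈ Finset.Icc 1 (2 * m - 1)) (V : ℕ → ℕ → ℕ → ℂ) (α : ℕ) :
    Tendsto (fun k : ℂ => (Complex.I * n + k * (1 - omega m j)) * solCoeff m V k α)
      (𝓝[≠] pole m n j) (𝓝 (residueCoeff V n j α)) := by
  rcases Nat.eq_zero_or_pos α with rfl | hα
  · simp only [solCoeff_zero, mul_one]
    rw [residueCoeff, if_neg (by omega)]
    exact tendsto_linear_factor hj
  · have h : Tendsto (fun k : ℂ => ∑ j' ∈ Finset.Icc 1 (2 * m - 1), ∑ n' ∈ Finset.Icc 1 α,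
        (Complex.I * n + k * (1 - omega m j)) *
          (V j' n' α / (Complex.I * n' + k * (1 - omega m j')))) (𝓝[≠] pole m n j)
        (𝓝 (∑ j' ∈ Finset.Icc 1 (2 * m - 1), ∑ n' ∈ Finset.Icc 1 α,
          if j' = j then if n' = n then V j' n' α else 0 else 0)) :=
      tendsto_finsetSum _ fun j' hj' => tendsto_finsetSum _ fun n' _ =>
        tendsto_linear_factor_mul_div hn hj hj' _
    have hlim : (∑ j' ∈ Finset.Icc 1 (2 * m - 1), ∑ n' ∈ Finset.Icc 1 α,
        if j' = j then if n' = n then V j' n' α else 0 else 0) = residueCoeff V n j α := by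
      rw [Finset.sum_eq_single_of_mem j hj fun j' _ h => by simp [h]]
      simp only [if_true, Finset.sum_ite_eq', Finset.mem_Icc, residueCoeff, hn, true_and]
    rw [hlim] at h
    refine h.congr fun k => ?_
    rw [solCoeff, if_neg (by omega), Finset.mul_sum]
    simp only [Finset.mul_sum]

lemma defect_const_mul (m : ℕ) (p : ℕ → ℕ → ℂ) (k a : ℂ) (c : ℕ → ℂ) (α : ℕ) :
    defect m p k (fun β => a * c β) α = a * defect m p k c α := by
  unfold defect
  rw [mul_add, Finset.mul_sum, Finset.mul_sum, Finset.mul_sum]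
  congr 1
  · ring
  · exact Finset.sum_congr rfl fun β _ => by ring

lemma tendsto_defect {m : ℕ} {p : ℕ → ℕ → ℂ} {l : Filter ℂ} {k₀ : ℂ} (hl : l ≤ 𝓝 k₀)
    {x : ℂ → ℕ → ℂ} {y : ℕ → ℂ} (hx : ∀ α, Tendsto (fun k => x k α) l (𝓝 (y α))) (α : ℕ) :
    Tendsto (fun k => defect m p k (x k) α) l (𝓝 (defect m p k₀ y α)) := by
  have h1 : Continuous fun k => charDiff m α k := by unfold charDiff; fun_prop
  have h2 : ∀ β, Continuous fun k => symbol m p (α - β) (k + Complex.I * β) := by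
    intro β; unfold symbol; fun_prop
  exact (((h1.tendsto k₀).mono_left hl).mul (hx α)).add ((tendsto_finsetSum _ fun β _ =>
    (((h2 β).tendsto k₀).mono_left hl).mul (hx β)).const_mul _)

/-- The residues at `k_{nj}` satisfy the recursion at `k_{nj}`. -/
lemma defect_residueCoeff {m n j : ℕ} (hn : 1 ≤ n) (hj : j ∈ Finset.Icc 1 (2 * m - 1))
    {p : ℕ → ℕ → ℂ} {V : ℕ → ℕ → ℕ → ℂ}
    (hV : ∀ k, IsRegularPoint m k → ∀ α, defect m p k (solCoeff m V k) α = 0) (α : ℕ) :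
    defect m p (pole m n j) (residueCoeff V n j) α = 0 := by
  have h := tendsto_defect (m := m) (p := p) nhdsWithin_le_nhds
    (tendsto_linear_factor_mul_solCoeff hn hj V) α
  refine tendsto_nhds_unique h (tendsto_const_nhds.congr' ?_)
  filter_upwards [eventually_isRegularPoint hj] with k hk
  rw [defect_const_mul, hV k hk, mul_zero]

/-- The residue of `f(t, k)` at `k_{nj}` has leading exponential `e^{i k_{nj} ω_j t}`, and since
`k_{nj} ω_j` is not one of the exceptional points, the recursion makes it a multiple of
`f(t, k_{nj} ω_j)`. -/
lemma residue_eq_mul_solCoeff {m n j : ℕ} (hm : 1 ≤ m) (hn : 1 ≤ n)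
    (hj : j ∈ Finset.Icc 1 (2 * m - 1)) {p : ℕ → ℕ → ℂ} {V : ℕ → ℕ → ℕ → ℂ}
    (hV : ∀ k, IsRegularPoint m k → ∀ α, defect m p k (solCoeff m V k) α = 0) (β : ℕ) :
    V j n (n + β) = V j n n * solCoeff m V (pole m n j * omega m j) β := by
  have hreg := isRegularPoint_pole_mul_omega (n := n) hj
  refine eq_mul_of_defect_eq_zero (x := fun β => V j n (n + β)) hm hreg (fun α => ?_)
    (hV _ hreg) (solCoeff_zero _ _ _) β
  have h := defect_residueCoeff hn hj hV (n + α)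
  rw [defect, charDiff_pole hm hj, Finset.sum_range_add, Finset.sum_eq_zero (fun β hβ => by
    rw [residueCoeff, if_neg (by simpa using hβ), mul_zero]), zero_add] at h
  rw [defect, ← h]
  simp only [residueCoeff, Nat.le_add_right, if_true]
  congr 2
  refine Finset.sum_congr rfl fun β _ => ?_
  rw [Nat.add_sub_add_left, pole_mul_omega hj]
  congr 2
  push_cast
  ring

/-- The limit in the definition of the spectral data may be taken term by term, so that
`S_{nj} = V_{nn}^{(j)}`. -/
lemma tendsto_linear_factor_mul_seriesSol {m n j : ℕ} (hm : 1 ≤ m) (hn : 1 ≤ n)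
    (hj : j ∈ Finset.Icc 1 (2 * m - 1)) {Q : ℕ → ℝ → ℂ} {p : ℕ → ℕ → ℂ}
    (hp : IsExpansion m Q p) {V : ℕ → ℕ → ℕ → ℂ}
    (hV : ∀ k, IsRegularPoint m k → ∀ α, defect m p k (solCoeff m V k) α = 0) {t : ℝ}
    (ht : 0 ≤ t) :
    Tendsto (fun k : ℂ => (Complex.I * n + k * (1 - omega m j)) * seriesSol m V t k)
      (𝓝[≠] pole m n j) (𝓝 (V j n n * seriesSol m V t (pole m n j * omega m j))) := by
  set k₀ := pole m n j with hk₀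
  have hexp : ∀ k, IsRegularPoint m k → seriesSol m V t k = expSum (solCoeff m V k) k t :=
    fun k hk => seriesSol_eq_expSum
      (summable_seriesTerm_iff.mpr (summable_norm_of_defect_eq_zero hm hp (hV k hk)) t ht)
  have hres := tendsto_linear_factor_mul_solCoeff hn hj V
  obtain ⟨N, hN⟩ := exists_uniform_decay hm hp (‖k₀‖ + 1)
  set B : ℝ := ∑ β ∈ Finset.range (N + 1), (‖residueCoeff V n j β‖ + 1) with hB
  have hnorm : ∀ᶠ k in 𝓝[≠] k₀, ‖k‖ ≤ ‖k₀‖ + 1 := by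
    have h : Tendsto (fun k : ℂ => ‖k‖) (𝓝[≠] k₀) (𝓝 ‖k₀‖) :=
      (continuous_norm.tendsto k₀).mono_left nhdsWithin_le_nhds
    exact h.eventually_le_const (by linarith)
  have hinit : ∀ᶠ k in 𝓝[≠] k₀, ∀ β ∈ Finset.range (N + 1),
      ‖(Complex.I * n + k * (1 - omega m j)) * solCoeff m V k β‖ ≤
        ‖residueCoeff V n j β‖ + 1 := by
    rw [Finset.eventually_all]
    exact fun β _ => (hres β).norm.eventually_le_const (by linarith)
  have hlim : Tendsto (fun k : ℂ => ∑' α : ℕ, (Complex.I * n + k * (1 - omega m j)) *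
      solCoeff m V k α * Complex.exp ((Complex.I * k - α) * t)) (𝓝[≠] k₀)
      (𝓝 (∑' α : ℕ, residueCoeff V n j α * Complex.exp ((Complex.I * k₀ - α) * t))) := by
    refine tendsto_tsum_of_dominated_convergence (bound := fun α : ℕ =>
      4 * B * (N + 1) ^ 2 * Real.exp ((‖k₀‖ + 1) * t) / ((α : ℝ) + 1) ^ 2)
      (summable_const_div_succ_sq _) (fun α => ?_) ?_
    · have h : Continuous fun k : ℂ => Complex.exp ((Complex.I * k - α) * t) := by fun_prop
      exact (hres α).mul ((h.tendsto k₀).mono_left nhdsWithin_le_nhds)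
    · filter_upwards [eventually_isRegularPoint hj, hnorm, hinit] with k hk hkn hki α
      have h1 := hN k hkn
        (fun α => (Complex.I * n + k * (1 - omega m j)) * solCoeff m V k α)
        (fun α _ => by rw [defect_const_mul, hV k hk, mul_zero]) B (fun β hβ => by
          have hmem : β ∈ Finset.range (N + 1) := Finset.mem_range.mpr (by omega)
          exact (hki β hmem).trans (Finset.single_le_sum
            (f := fun β => ‖residueCoeff V n j β‖ + 1) (fun _ _ => by positivity) hmem)) α
      have h2 : ‖Complex.exp ((Complex.I * k - α) * t)‖ ≤ Real.exp ((‖k₀‖ + 1) * t) := by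
        rw [norm_exp_exponent, ← Real.exp_add, Real.exp_le_exp]
        have h3 : -k.im ≤ ‖k₀‖ + 1 :=
          ((neg_le_abs _).trans (Complex.abs_im_le_norm k)).trans hkn
        have h4 : 0 ≤ (α : ℝ) * t := by positivity
        nlinarith
      rw [norm_mul]
      calc _ ≤ 4 * B * (N + 1) ^ 2 / ((α : ℝ) + 1) ^ 2 * Real.exp ((‖k₀‖ + 1) * t) :=
            mul_le_mul h1 h2 (norm_nonneg _) ((norm_nonneg _).trans h1)
        _ = _ := by ring
  have hval : ∑' α : ℕ, residueCoeff V n j α * Complex.exp ((Complex.I * k₀ - α) * t) =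
      V j n n * seriesSol m V t (k₀ * omega m j) := by
    have hreg := isRegularPoint_pole_mul_omega (n := n) hj
    rw [hexp _ hreg, expSum, ← tsum_mul_left]
    rw [← (add_right_injective n).tsum_eq]
    · refine tsum_congr fun β => ?_
      rw [residueCoeff, if_pos (Nat.le_add_right n β), residue_eq_mul_solCoeff hm hn hj hV,
        ← mul_assoc]
      congr 2
      rw [hk₀, pole_mul_omega hj]
      push_cast
      linear_combination -((n : ℂ) * t) * Complex.I_mul_I
    · intro α hα
      have hle : n ≤ α := by
        by_contra h
        exact hα (by simp only [residueCoeff, if_neg h, zero_mul])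
      exact ⟨α - n, Nat.add_sub_cancel' hle⟩
  rw [← hval]
  refine hlim.congr' ?_
  filter_upwards [eventually_isRegularPoint hj] with k hk
  rw [hexp k hk, expSum, ← tsum_mul_left]
  exact tsum_congr fun α => by ring

/-- The spectral data are the numbers `V_{nn}^{(j)}`, because `f(t, k_{nj} ω_j)` does not vanish
identically. -/
lemma IsSpectralData.exists_solution {m : ℕ} (hm : 1 ≤ m) {Q : ℕ → ℝ → ℂ} {p : ℕ → ℕ → ℂ}
    (hp : IsExpansion m Q p) {S : ℕ → ℕ → ℂ} (hS : IsSpectralData m Q S) :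
    ∃ V, (∀ k, IsRegularPoint m k → ∀ α, defect m p k (solCoeff m V k) α = 0) ∧
      ∀ n, 1 ≤ n → ∀ j ∈ Finset.Icc 1 (2 * m - 1), S n j = V j n n := by
  obtain ⟨V, hV, hlim⟩ := hS
  have hV' := (isSolutionSystem_iff hm hp).mp hV
  refine ⟨V, hV', fun n hn j hj => ?_⟩
  by_contra hne
  have hreg := isRegularPoint_pole_mul_omega (n := n) hj
  have hzero : ∀ t : ℝ, 0 < t →
      expSum (solCoeff m V (pole m n j * omega m j)) (pole m n j * omega m j) t = 0 := by
    intro t ht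
    have h := tendsto_nhds_unique (hlim n hn j hj t ht.le)
      (tendsto_linear_factor_mul_seriesSol hm hn hj hp hV' ht.le)
    rw [← seriesSol_eq_expSum ((hV _ hreg).1 t ht.le)]
    exact (mul_eq_mul_right_iff.mp h).resolve_left hne
  have h1 := eq_zero_of_expSum_eq_zero (ExpSummable.of_summable_norm
    (summable_norm_of_defect_eq_zero hm hp (hV' _ hreg))) _ hzero 0
  rw [solCoeff_zero] at h1
  exact one_ne_zero h1

lemma exists_isSpectralData {m : ℕ} (hm : 1 ≤ m) {Q : ℕ → ℝ → ℂ} {p : ℕ → ℕ → ℂ}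
    (hp : IsExpansion m Q p) : ∃ S, IsSpectralData m Q S := by
  obtain ⟨V, hV⟩ := exists_defect_solCoeff_eq_zero hm p
  exact ⟨fun n j => V j n n, V, (isSolutionSystem_iff hm hp).mpr hV, fun n hn j hj t ht =>
    tendsto_linear_factor_mul_seriesSol hm hn hj hp hV ht⟩

/-! ### The inverse problem -/

/-- The spectral data determine all coefficients of `f(t, k)`: the numerators `V_{nα}^{(j)}` are
multiples, by the spectral data, of coefficients of index `α - n < α` at `k_{nj} ω_j`. -/
lemma solCoeff_eq_of_diagonal_eq {m : ℕ} (hm : 1 ≤ m) {p p' : ℕ → ℕ → ℂ} {V V' : ℕ → ℕ → ℕ → ℂ}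
    (hV : ∀ k, IsRegularPoint m k → ∀ α, defect m p k (solCoeff m V k) α = 0)
    (hV' : ∀ k, IsRegularPoint m k → ∀ α, defect m p' k (solCoeff m V' k) α = 0)
    (h : ∀ n, 1 ≤ n → ∀ j ∈ Finset.Icc 1 (2 * m - 1), V j n n = V' j n n) (α : ℕ) (k : ℂ) :
    solCoeff m V k α = solCoeff m V' k α := by
  induction α using Nat.strong_induction_on generalizing k with
  | _ α ih =>
    rcases Nat.eq_zero_or_pos α with rfl | hα
    · rw [solCoeff_zero, solCoeff_zero]
    · rw [solCoeff, solCoeff, if_neg (by omega), if_neg (by omega)]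
      refine Finset.sum_congr rfl fun j hj => Finset.sum_congr rfl fun n hn => ?_
      obtain ⟨hn1, hnα⟩ := Finset.mem_Icc.mp hn
      obtain ⟨β, rfl⟩ := Nat.exists_eq_add_of_le hnα
      rw [residue_eq_mul_solCoeff hm hn1 hj hV, residue_eq_mul_solCoeff hm hn1 hj hV',
        h n hn1 j hj, ih β (by omega)]

lemma eq_of_symbol_eq {m : ℕ} {p p' : ℕ → ℕ → ℂ} {s : ℕ}
    (h : ∀ k, IsRegularPoint m k → symbol m p s k = symbol m p' s k) {γ : ℕ}
    (hγ : γ ∈ Finset.range (2 * m - 1)) : p γ s = p' γ s := by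
  let T : (ℕ → ℕ → ℂ) → Polynomial ℂ := fun p =>
    ∑ γ ∈ Finset.range (2 * m - 1), Polynomial.monomial γ (p γ s)
  have hT : ∀ p k, (T p).eval k = symbol m p s k := by
    intro p k
    simp [T, symbol, Polynomial.eval_finsetSum]
  have hcoeff : ∀ p, (T p).coeff γ = p γ s := by
    intro p
    simp only [T, Polynomial.finsetSum_coeff, Polynomial.coeff_monomial]
    rw [Finset.sum_ite_eq', if_pos hγ]
  have hTT : T p = T p' := by
    refine Polynomial.eq_of_infinite_eval_eq _ _ (Set.Infinite.mono (s := Set.range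
      fun n : ℕ => (n : ℂ)) ?_ (Set.infinite_range_of_injective Nat.cast_injective))
    rintro _ ⟨n, rfl⟩
    rw [Set.mem_ofPred_eq, hT, hT]
    exact h _ (isRegularPoint_of_im_nonneg (by simp))
  rw [← hcoeff p, hTT, hcoeff]

/-- Equal solutions of the two recursions force equal symbols: the recursion of index `s` contains
the symbol of index `s` at `k` itself, with the factor `c_0 = 1`, and otherwise only symbols of
smaller index. -/
lemma expansion_eq_of_solution_eq {m : ℕ} {Q Q' : ℕ → ℝ → ℂ} {p p' : ℕ → ℕ → ℂ}
    (hp : IsExpansion m Q p) (hp' : IsExpansion m Q' p') {c : ℂ → ℕ → ℂ} (hc0 : ∀ k, c k 0 = 1)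
    (hc : ∀ k, IsRegularPoint m k → ∀ α, defect m p k (c k) α = 0)
    (hc' : ∀ k, IsRegularPoint m k → ∀ α, defect m p' k (c k) α = 0) (s : ℕ) :
    ∀ γ ∈ Finset.range (2 * m - 1), p γ s = p' γ s := by
  induction s using Nat.strong_induction_on with
  | _ s ih =>
    intro γ hγ
    rcases Nat.eq_zero_or_pos s with rfl | hs
    · rw [hp.zero, hp'.zero]
    · refine eq_of_symbol_eq (fun k hk => ?_) hγ
      obtain ⟨r, rfl⟩ : ∃ r, s = r + 1 := ⟨s - 1, by omega⟩
      have h1 := hc k hk (r + 1)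
      have h2 := hc' k hk (r + 1)
      have hsum : ∑ β ∈ Finset.range r, symbol m p (r + 1 - (β + 1))
            (k + Complex.I * (β + 1 : ℕ)) * c k (β + 1) =
          ∑ β ∈ Finset.range r, symbol m p' (r + 1 - (β + 1))
            (k + Complex.I * (β + 1 : ℕ)) * c k (β + 1) := by
        refine Finset.sum_congr rfl fun β _ => ?_
        congr 1
        exact Finset.sum_congr rfl fun γ hγ => by rw [ih _ (by omega) γ hγ]
      rw [defect, Finset.sum_range_succ', hc0] at h1 h2
      simp only [Nat.sub_zero, Nat.cast_zero, mul_zero, add_zero, mul_one] at h1 h2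
      have h3 : ((-1 : ℂ) ^ m) ≠ 0 := pow_ne_zero _ (neg_ne_zero.mpr one_ne_zero)
      refine mul_left_cancel₀ h3 ?_
      linear_combination h1 - h2 - (-1) ^ m * hsum

end

end GasymovInverse

theorem theorem3 (m : ℕ) (hm : 1 ≤ m) :
    -- every equation of the class has spectral data, and they are unique
    (∀ Q : ℕ → ℝ → ℂ, GasymovInverse.InClass m Q →
      (∃ S : ℕ → ℕ → ℂ, GasymovInverse.IsSpectralData m Q S) ∧
      ∀ S S' : ℕ → ℕ → ℂ,
        GasymovInverse.IsSpectralData m Q S → GasymovInverse.IsSpectralData m Q S' →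
        ∀ n : ℕ, 1 ≤ n → ∀ j ∈ Finset.Icc 1 (2 * m - 1), S n j = S' n j) ∧
    -- the spectral data determine the coefficients
    (∀ Q Q' : ℕ → ℝ → ℂ, GasymovInverse.InClass m Q → GasymovInverse.InClass m Q' →
      ∀ S S' : ℕ → ℕ → ℂ,
        GasymovInverse.IsSpectralData m Q S → GasymovInverse.IsSpectralData m Q' S' →
        (∀ n : ℕ, 1 ≤ n → ∀ j ∈ Finset.Icc 1 (2 * m - 1), S n j = S' n j) →
        ∀ γ ∈ Finset.range (2 * m - 1), ∀ t : ℝ, 0 ≤ t → Q γ t = Q' γ t) := by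
  open GasymovInverse in
  refine ⟨fun Q hQ => ?_, fun Q Q' hQ hQ' S S' hS hS' hSS γ hγ t ht => ?_⟩
  · obtain ⟨p, hp⟩ := hQ.exists_isExpansion
    refine ⟨exists_isSpectralData hm hp, fun S S' hS hS' n hn j hj => ?_⟩
    obtain ⟨V, hV, hSV⟩ := hS.exists_solution hm hp
    obtain ⟨V', hV', hSV'⟩ := hS'.exists_solution hm hp
    have hcoeff : ∀ k, IsRegularPoint m k → solCoeff m V k = solCoeff m V' k := by
      intro k hk
      funext α
      have h := eq_mul_of_defect_eq_zero hm hk (hV k hk) (hV' k hk) (solCoeff_zero m V' k) α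
      rwa [solCoeff_zero, one_mul] at h
    have hlim := tendsto_linear_factor_mul_solCoeff hn hj V n
    have hlim' := tendsto_linear_factor_mul_solCoeff hn hj V' n
    have heq := tendsto_nhds_unique hlim (hlim'.congr' (by
      filter_upwards [eventually_isRegularPoint hj] with k hk
      rw [hcoeff k hk]))
    rw [residueCoeff, residueCoeff, if_pos le_rfl, if_pos le_rfl] at heq
    rw [hSV n hn j hj, hSV' n hn j hj, heq]
  · obtain ⟨p, hp⟩ := hQ.exists_isExpansion
    obtain ⟨p', hp'⟩ := hQ'.exists_isExpansion
    obtain ⟨V, hV, hSV⟩ := hS.exists_solution hm hp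
    obtain ⟨V', hV', hSV'⟩ := hS'.exists_solution hm hp'
    have hcoeff : ∀ k, solCoeff m V' k = solCoeff m V k := fun k => funext fun α =>
      solCoeff_eq_of_diagonal_eq hm hV' hV (fun n hn j hj => by
        rw [← hSV n hn j hj, ← hSV' n hn j hj, hSS n hn j hj]) α k
    have hpp := expansion_eq_of_solution_eq hp hp' (c := fun k => solCoeff m V k)
      (solCoeff_zero m V) hV fun k hk α => by rw [← hcoeff k]; exact hV' k hk α
    rw [hp.eq γ hγ t ht, hp'.eq γ hγ t ht]
    congr 1
    exact tsum_congr fun n => by rw [hpp n γ hγ]
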